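/- Let $k\ge 1$ be an integer. For finite strings $x,y$ let $|LCS(x;y)|$ be the length of their longest common (not necessarily contiguous) subsequences. An alignment of $x$ and $y$ is a non-crossing set of pairs of positions, one in $x$ and one in $y$, carrying equal letters, each position being used at most once; positions that are in no pair are aligned with gaps; the alignment is optimal if its number of pairs is $|LCS(x;y)|$. Let $(X^*_i)_{i\ge1}$ and $(Y_i)_{i\ge 1}$ be independent sequences of iid letters, uniform on $\{1,\dots,k\}$, and set $$\gamma_k^*=\lim_{n\to\infty}\frac{\mathbb E|LCS(X^*_1\cdots X^*_n;Y_1\cdots Y_n)|}{n},\qquad \gamma_k(p)=\lim_{n\to\infty}\frac{\mathbb E|LCS(X^*_1\cdots X^*_{n-np};Y_1\cdots Y_{n+np})|}{n}\quad(-1<p<1),$$ where real indices are rounded to the nearest positive integers. Let $p_M\in[0,1)$ be the largest point of $(-1,1)$ at which $\gamma_k$ attains its maximum. Suppose that $k\gamma_k^*>2$ and that $\gamma_k$ is differentiable at $p_M$, and let $\tfrac12<\alpha<\beta<1$. For $d\ge1$ let $\ell$ be an even rounding of $d^\beta$ (an even natural number with $|\ell-d^\beta|<2$), let $c$ be a letter,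 let $X^*=X_1^*\cdots X^*_{2d}$ and $Y=Y_1\cdots Y_{2d}$, and let $X=X_1\cdots X_{2d}$ be given by $X_i=c$ for $d-\ell/2<i\le d+\ell/2$ (the block) and $X_i=X_i^*$ for all other $i$. Then: 1. There is a constant $C_E>0$, independent of $d$, $\ell$ and $c$, such that for every $d\ge1$, with probability at least $1-e^{-C_Ed^{2\alpha-1}}$, every optimal alignment of $X$ and $Y$ aligns at most $d^\alpha-1$ symbols of the block with letters; and, also with probability at least $1-e^{-C_Ed^{2\alpha-1}}$, $$|LCS(X_1\cdots X_{d-\ell/2}X_{d+\ell/2+1}\cdots X_{2d};Y)|+d^\alpha>|LCS(X;Y)|.$$ 2. For every constant $\gamma_k^a<\gamma_k^*$ there is a constant $C_K>0$, independent of $d$, $\ell$ and $c$, such that for every $d\ge1$, $$\mathbb P\Big(|LCS(X^*;Y)|-|LCS(X;Y)|\ge\tfrac{\gamma_k^a}{2}d^\beta-d^\alpha\Big)\ge1-e^{-C_Kd^{2\alpha-1}}.$$ -/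

import Mathlib

open MeasureTheory ProbabilityTheory Filter Topology

noncomputable section

namespace SparseBlock

/-- The length `|LCS(x; y)|` of a longest common subsequence of two finite strings: the greatest
length of a string that is a (not necessarily contiguous) subsequence of both. -/
def lcsLen {A : Type*} (x y : List A) : ℕ :=
  sSup {r : ℕ | ∃ w : List A, w.Sublist x ∧ w.Sublist y ∧ w.length = r}

/-- An alignment of `x` and `y` is recorded by the finite set of its aligned pairs of positions
(counted from `0`): aligned letters are equal, and the pairs do not cross (in particular no
position is used twice). A position that occurs in no pair is aligned with a gap. The score of
the alignment is the number of its pairs. -/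
structure IsAlignment {A : Type*} (x y : List A) (π : Finset (ℕ × ℕ)) : Prop where
  eq_letters : ∀ p ∈ π, ∃ a : A, x[p.1]? = some a ∧ y[p.2]? = some a
  monotone : ∀ p ∈ π, ∀ q ∈ π, p.1 < q.1 ↔ p.2 < q.2

/-- An alignment is optimal if its score is the length of the longest common subsequences. -/
def IsOptimalAlignment {A : Type*} (x y : List A) (π : Finset (ℕ × ℕ)) : Prop :=
  IsAlignment x y π ∧ π.card = lcsLen x y

/-- `E |LCS(X_1 … X_m; Y_1 … Y_n)|` for independent strings of iid letters, uniform on `k`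
letters. -/
def meanLcs (k m n : ℕ) : ℝ :=
  (∑ x : Fin m → Fin k, ∑ y : Fin n → Fin k, (lcsLen (List.ofFn x) (List.ofFn y) : ℝ)) /
    (k : ℝ) ^ (m + n)

/-- The constant `γ*_k = lim E |LCS(X_1 … X_n; Y_1 … Y_n)| / n`. -/
def gammaStar (k : ℕ) : ℝ :=
  limUnder atTop (fun n : ℕ => meanLcs k n n / n)

/-- Rounding to the nearest positive integer. -/
def roundPos (x : ℝ) : ℕ := max 1 (round x).toNat

/-- `γ_k(n, p) = E |LCS(X_1 … X_{n - np}; Y_1 … Y_{n + np})| / n`. -/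
def gammaN (k n : ℕ) (p : ℝ) : ℝ :=
  meanLcs k (roundPos (n - n * p)) (roundPos (n + n * p)) / n

/-- The mean LCS function `γ_k(p) = lim γ_k(n, p)`, of interest for `-1 < p < 1`. -/
def gammaFn (k : ℕ) (p : ℝ) : ℝ :=
  limUnder atTop (fun n : ℕ => gammaN k n p)

/-- `p_M`: the largest point of `(-1, 1)` at which the mean LCS function is maximal. -/
def pM (k : ℕ) : ℝ :=
  sSup {p : ℝ | p ∈ Set.Ioo (-1 : ℝ) 1 ∧ IsMaxOn (gammaFn k) (Set.Ioo (-1) 1) p}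

/-- `X` and `Y` are two independent strings of length `n` of iid letters, uniform on `k`
letters. -/
structure IsIIDUniformPair {Ω : Type*} [MeasurableSpace Ω] (μ : Measure Ω) {k n : ℕ}
    (X Y : Fin n → Ω → Fin k) : Prop where
  measurable_left : ∀ i, Measurable (X i)
  measurable_right : ∀ i, Measurable (Y i)
  indep : iIndepFun (Sum.elim X Y) μ
  uniform_left : ∀ i a, μ.real {ω | X i ω = a} = 1 / k
  uniform_right : ∀ i a, μ.real {ω | Y i ω = a} = 1 / k

/-- `ℓ` is an even rounding of `d ^ β`. -/
def IsBlockLength (β : ℝ) (d ℓ : ℕ) : Prop :=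
  Even ℓ ∧ |(ℓ : ℝ) - (d : ℝ) ^ β| < 2

/-- The (0-based) position `i` lies in the middle segment of length `ℓ` (even) of a string of
length `2d`, that is, `d - ℓ/2 ≤ i < d + ℓ/2`. -/
def InBlock (d ℓ i : ℕ) : Prop :=
  d ≤ i + ℓ / 2 ∧ i < d + ℓ / 2

open Classical in
/-- The string of length `2d` obtained from `x` by writing the letter `c` at all positions of
the middle segment of length `ℓ`. -/
def withBlock {k : ℕ} (d ℓ : ℕ) (c : Fin k) (x : Fin (2 * d) → Fin k) : List (Fin k) :=
  List.ofFn (fun i : Fin (2 * d) => if InBlock d ℓ i then c else x i)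

/-- The string obtained from `x`, of length `2d`, by cutting out the middle segment of
length `ℓ`. -/
def cutBlock {A : Type*} (d ℓ : ℕ) (x : List A) : List A :=
  x.take (d - ℓ / 2) ++ x.drop (d + ℓ / 2)

open Classical in
/-- The number of positions of the middle segment that the alignment `π` aligns with letters. -/
def blockMatches (d ℓ : ℕ) (π : Finset (ℕ × ℕ)) : ℕ :=
  (π.filter (fun p => InBlock d ℓ p.1)).card

variable {Ω : Type*} {k d : ℕ}

/-- The event that every optimal alignment of `X` (the string `Xs` with the constant block of
`c`s inserted) and `Y` aligns at most `d ^ α - 1` symbols of the block with letters. -/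
def eventGaps (α : ℝ) (ℓ : ℕ) (c : Fin k) (Xs Y : Fin (2 * d) → Ω → Fin k) : Set Ω :=
  {ω | ∀ π : Finset (ℕ × ℕ),
    IsOptimalAlignment (withBlock d ℓ c (fun i => Xs i ω)) (List.ofFn (fun i => Y i ω)) π →
      (blockMatches d ℓ π : ℝ) ≤ (d : ℝ) ^ α - 1}

/-- The event that cutting out the block lowers the LCS length by less than `d ^ α`. -/
def eventCut (α : ℝ) (ℓ : ℕ) (c : Fin k) (Xs Y : Fin (2 * d) → Ω → Fin k) : Set Ω :=
  {ω | (lcsLen (withBlock d ℓ c (fun i => Xs i ω)) (List.ofFn (fun i => Y i ω)) : ℝ) <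
    (lcsLen (cutBlock d ℓ (withBlock d ℓ c (fun i => Xs i ω)))
      (List.ofFn (fun i => Y i ω)) : ℝ) + (d : ℝ) ^ α}

/-- The event `K^d` that replacing the block by iid symbols (which turns `X` back into `Xs`)
raises the LCS length by at least `(γa / 2) d ^ β - d ^ α`. -/
def eventK (α β γa : ℝ) (ℓ : ℕ) (c : Fin k) (Xs Y : Fin (2 * d) → Ω → Fin k) : Set Ω :=
  {ω | γa / 2 * (d : ℝ) ^ β - (d : ℝ) ^ α ≤
    (lcsLen (List.ofFn (fun i => Xs i ω)) (List.ofFn (fun i => Y i ω)) : ℝ) -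
      (lcsLen (withBlock d ℓ c (fun i => Xs i ω)) (List.ofFn (fun i => Y i ω)) : ℝ)}

end SparseBlock

end

universe u

/-!
Write `f m n = meanLcs k m n`, and let `a = d - ℓ/2` be the length of the two parts of `X` outside
the block.

An alignment of `X` and `Y` splits at the block: if the block faces a segment of `h` letters of
`Y`, of which `m` are aligned with block letters, then the rest of the alignment compares two
pairs of strings whose mean scores add up to at most `f (2a) (2d - h)`, by superadditivity, while
`m` is at most the number of `c`s in the segment, about `h / k`. Dropping the block and comparing
the rest of `X` with all of `Y` scores about `f (2a) (2d)`. Hence the block can keep many letters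
only if `f (2a) (2d) - f (2a) (2d - h)` is not larger than `h / k`. But an additional letter of `Y`
is worth almost `γ*/2 > 1/k` on average, so `h`, and with it `m`, has to be small
(`IsTypical.blockMatches_le`). In the same way, `ℓ` additional letters of `X` in place of the block
are worth almost `ℓ γ*/2`, which is the second part. All scores are within a small multiple of
`d ^ α` of their means outside an event of probability `exp (-C d ^ (2α - 1))`, by the bounded
differences inequality (`avg_deviation_le`).

What has to be shown is the lower bound on the increments of `f` for strings of almost equal length
(`exists_mul_sub_le_meanLcs_sub`), with an error of at most a small multiple of `d ^ α`. The means
`f` are not known to be close enough to their limits for that at scale `d`. Instead, one cuts an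
optimal alignment of strings of lengths `m` and `b` into pieces with `s` letters of the first
string, where `s` is a large multiple of the number `h` of letters to be added, and `h` is a small
multiple of `m ^ α`. One of the pieces has at most about `s` letters `t` of the second string.
Removing this piece and putting back one with `h` more letters shows
`f m (b + h) - f m b ≥ f s (t + h) - f s t`, up to fluctuations (`exists_meanLcs_le_add`).
For the right hand side the convergence of `f` to the shape function `F (x, y) = shape k x y` is
enough, as an error of order `o(s)` is allowed. The function `F` is superadditive and homogeneous,
hence concave, and symmetric; so `gammaFn k p = F (1 - p, 1 + p)` is maximal at `0`, with value
`γ*`, and `0 ≤ pM k < 1`. At the maximum `pM k` the derivative of `gammaFn k` vanishes, so that an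
additional letter raises `F` by almost `γ*/2` in directions slightly beyond `pM k`, and by
concavity also in all directions before (`exists_le_shape_sub`). This is the only place where
differentiability enters; for `pM k = 0` it is needed because the lengths `2a` and `2d` differ.

For the finitely many small `d` it suffices that each event has positive probability, which is
seen from constant strings of a letter other than `c`.
-/

namespace SparseBlock

/-! ### Longest common subsequences -/

section LCS

variable {A : Type*}

theorem bddAbove_lcs (x y : List A) :
    BddAbove {r : ℕ | ∃ w : List A, w.Sublist x ∧ w.Sublist y ∧ w.length = r} :=
  ⟨x.length, by rintro r ⟨w, hx, -, rfl⟩; exact hx.length_le⟩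

theorem length_le_lcsLen {w x y : List A} (hx : w.Sublist x) (hy : w.Sublist y) :
    w.length ≤ lcsLen x y :=
  le_csSup (bddAbove_lcs x y) ⟨w, hx, hy, rfl⟩

theorem exists_lcs (x y : List A) :
    ∃ w : List A, w.Sublist x ∧ w.Sublist y ∧ w.length = lcsLen x y :=
  Nat.sSup_mem (s := {r : ℕ | ∃ w : List A, w.Sublist x ∧ w.Sublist y ∧ w.length = r})
    ⟨0, [], by simp, by simp, rfl⟩ (bddAbove_lcs x y)

theorem lcsLen_comm (x y : List A) : lcsLen x y = lcsLen y x := by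
  unfold lcsLen
  congr 1
  ext r
  constructor <;> rintro ⟨w, h1, h2, h3⟩ <;> exact ⟨w, h2, h1, h3⟩

theorem lcsLen_le_length_left (x y : List A) : lcsLen x y ≤ x.length := by
  obtain ⟨w, hx, -, hw⟩ := exists_lcs x y
  exact hw ▸ hx.length_le

theorem lcsLen_mono {x x' y y' : List A} (hx : x.Sublist x') (hy : y.Sublist y') :
    lcsLen x y ≤ lcsLen x' y' := by
  obtain ⟨w, h1, h2, hw⟩ := exists_lcs x y
  exact hw ▸ length_le_lcsLen (h1.trans hx) (h2.trans hy)

theorem lcsLen_self (x : List A) : lcsLen x x = x.length :=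
  le_antisymm (lcsLen_le_length_left x x) (length_le_lcsLen (List.Sublist.refl x) (List.Sublist.refl x))

theorem add_lcsLen_le (x x' y y' : List A) :
    lcsLen x y + lcsLen x' y' ≤ lcsLen (x ++ x') (y ++ y') := by
  obtain ⟨w, h1, h2, hw⟩ := exists_lcs x y
  obtain ⟨w', h1', h2', hw'⟩ := exists_lcs x' y'
  rw [← hw, ← hw', ← List.length_append]
  exact length_le_lcsLen (h1.append h1') (h2.append h2')

/-- Cutting the first string of an optimal alignment cuts the second one, without loss. -/
theorem exists_lcsLen_append_le (x x' y : List A) :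
    ∃ y₁ y₂ : List A, y = y₁ ++ y₂ ∧ lcsLen (x ++ x') y ≤ lcsLen x y₁ + lcsLen x' y₂ := by
  obtain ⟨w, h1, h2, hw⟩ := exists_lcs (x ++ x') y
  obtain ⟨w₁, w₂, rfl, hx, hx'⟩ := List.sublist_append_iff.1 h1
  obtain ⟨y₁, y₂, rfl, hy₁, hy₂⟩ := List.append_sublist_iff.1 h2
  refine ⟨y₁, y₂, rfl, ?_⟩
  rw [← hw, List.length_append]
  exact Nat.add_le_add (length_le_lcsLen hx hy₁) (length_le_lcsLen hx' hy₂)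

theorem lcsLen_append_left_le (x x' y : List A) :
    lcsLen (x ++ x') y ≤ lcsLen x y + x'.length := by
  obtain ⟨y₁, y₂, rfl, h⟩ := exists_lcsLen_append_le x x' y
  exact h.trans (Nat.add_le_add (lcsLen_mono (List.Sublist.refl _) (List.sublist_append_left _ _))
    (lcsLen_le_length_left _ _))

/-- Deleting a segment of the first string costs at most its length. -/
theorem lcsLen_insert_le (x₁ u x₂ y : List A) :
    lcsLen (x₁ ++ (u ++ x₂)) y ≤ lcsLen (x₁ ++ x₂) y + u.length := by
  obtain ⟨y₁, y', rfl, h⟩ := exists_lcsLen_append_le x₁ (u ++ x₂) y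
  obtain ⟨y₂, y₃, rfl, h'⟩ := exists_lcsLen_append_le u x₂ y'
  have h1 := lcsLen_le_length_left u y₂
  have h2 := add_lcsLen_le x₁ x₂ y₁ y₃
  have h3 : lcsLen (x₁ ++ x₂) (y₁ ++ y₃) ≤ lcsLen (x₁ ++ x₂) (y₁ ++ (y₂ ++ y₃)) :=
    lcsLen_mono (List.Sublist.refl _)
      ((List.Sublist.refl _).append (List.sublist_append_right _ _))
  omega

/-- Changing one letter of the first string changes the LCS length by at most one. -/
theorem lcsLen_subst_left_le (x₁ x₂ y : List A) (a b : A) :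
    lcsLen (x₁ ++ a :: x₂) y ≤ lcsLen (x₁ ++ b :: x₂) y + 1 := by
  have h1 := lcsLen_insert_le x₁ [a] x₂ y
  have h2 : lcsLen (x₁ ++ x₂) y ≤ lcsLen (x₁ ++ b :: x₂) y :=
    lcsLen_mono ((List.Sublist.refl _).append (List.sublist_cons_self _ _)) (List.Sublist.refl _)
  simp only [List.cons_append, List.nil_append, List.length_cons, List.length_nil] at h1
  omega

theorem lcsLen_subst_right_le (x y₁ y₂ : List A) (a b : A) :
    lcsLen x (y₁ ++ a :: y₂) ≤ lcsLen x (y₁ ++ b :: y₂) + 1 := by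
  rw [lcsLen_comm x, lcsLen_comm x]
  exact lcsLen_subst_left_le _ _ _ _ _

/-- If `x` contains `q` disjoint segments of length `s` and `y` is shorter than `q * (T + 1)`,
an optimal alignment of `x` and `y` matches one of these segments to a segment of `y` of length
at most `T`; cutting out both splits the score. -/
theorem exists_short_piece (s T : ℕ) : ∀ (q : ℕ) (x y : List A), q * s ≤ x.length →
    y.length < q * (T + 1) →
    ∃ u₁ u₂ u₃ v₁ v₂ v₃ : List A, x = u₁ ++ (u₂ ++ u₃) ∧ y = v₁ ++ (v₂ ++ v₃) ∧
      u₂.length = s ∧ v₂.length ≤ T ∧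
      lcsLen x y ≤ lcsLen (u₁ ++ u₃) (v₁ ++ v₃) + lcsLen u₂ v₂
  | 0, x, y, _, hy => by simp at hy
  | q + 1, x, y, hx, hy => by
    rw [Nat.succ_mul] at hx hy
    obtain ⟨y₁, y₂, hyy, h⟩ := exists_lcsLen_append_le (x.take s) (x.drop s) y
    rw [List.take_append_drop] at h
    by_cases hT : y₁.length ≤ T
    · refine ⟨[], x.take s, x.drop s, [], y₁, y₂, by simp, by simpa using hyy, ?_, hT, ?_⟩
      · rw [List.length_take]; omega
      · simpa [add_comm] using h
    · have hl : y.length = y₁.length + y₂.length := by rw [hyy, List.length_append]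
      obtain ⟨u₁, u₂, u₃, v₁, v₂, v₃, hu, hv, hs, ht, h'⟩ :=
        exists_short_piece s T q (x.drop s) y₂ (by rw [List.length_drop]; omega) (by omega)
      refine ⟨x.take s ++ u₁, u₂, u₃, y₁ ++ v₁, v₂, v₃, ?_, ?_, hs, ht, ?_⟩
      · rw [List.append_assoc, ← hu, List.take_append_drop]
      · rw [List.append_assoc, ← hv, hyy]
      · have := add_lcsLen_le (x.take s) (u₁ ++ u₃) y₁ (v₁ ++ v₃)
        rw [List.append_assoc, List.append_assoc]
        omega

theorem lcsLen_replicate_le [DecidableEq A] (n : ℕ) (c : A) (y : List A) :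
    lcsLen (List.replicate n c) y ≤ y.count c := by
  obtain ⟨w, hx, hy, hw⟩ := exists_lcs (List.replicate n c) y
  obtain ⟨m, -, rfl⟩ := List.sublist_replicate_iff.1 hx
  rw [← hw, List.length_replicate]
  exact List.replicate_sublist_iff.1 hy |>.trans le_rfl

end LCS

/-! ### Alignments -/

section Alignment

variable {A : Type*}

/-- The pairs of an alignment whose first position lies before `n` and the remaining ones use
disjoint initial and final parts of the second string, and so bound two separate alignments. -/
theorem IsAlignment.exists_split {x₁ x₂ y : List A} {π : Finset (ℕ × ℕ)}
    (h : IsAlignment (x₁ ++ x₂) y π) :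
    ∃ (y₁ y₂ : List A) (π₂ : Finset (ℕ × ℕ)), y = y₁ ++ y₂ ∧
      IsAlignment x₁ y₁ (π.filter (fun p => p.1 < x₁.length)) ∧ IsAlignment x₂ y₂ π₂ ∧
      ∀ (P : ℕ → Prop) [DecidablePred P],
        (π₂.filter (fun p => P p.1)).card =
          (π.filter (fun p => x₁.length ≤ p.1 ∧ P (p.1 - x₁.length))).card := by
  classical
  set n := x₁.length with hn
  set i : ℕ := (π.filter (fun p => p.1 < n)).sup (fun p => p.2 + 1) with hi
  have hlt : ∀ p ∈ π, p.1 < n → p.2 < i := fun p hp hpn =>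
    Finset.le_sup (f := fun p : ℕ × ℕ => p.2 + 1) (Finset.mem_filter.2 ⟨hp, hpn⟩)
  have hge : ∀ p ∈ π, n ≤ p.1 → i ≤ p.2 := by
    intro p hp hpn
    refine Finset.sup_le fun q hq => ?_
    obtain ⟨hq, hqn⟩ := Finset.mem_filter.1 hq
    exact (h.monotone q hq p hp).1 (by omega)
  have hinj : Set.InjOn (fun p : ℕ × ℕ => (p.1 - n, p.2 - i))
      (π.filter (fun p => n ≤ p.1) : Finset (ℕ × ℕ)) := by
    intro p hp q hq hpq
    obtain ⟨hp, hpn⟩ := Finset.mem_filter.1 hp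
    obtain ⟨hq, hqn⟩ := Finset.mem_filter.1 hq
    have := hge p hp hpn
    have := hge q hq hqn
    simp only [Prod.mk.injEq] at hpq
    ext <;> omega
  refine ⟨y.take i, y.drop i, (π.filter (fun p => n ≤ p.1)).image (fun p => (p.1 - n, p.2 - i)),
    (List.take_append_drop _ _).symm, ⟨?_, ?_⟩, ⟨?_, ?_⟩, ?_⟩
  · intro p hp
    obtain ⟨hp, hpn⟩ := Finset.mem_filter.1 hp
    obtain ⟨a, h1, h2⟩ := h.eq_letters p hp
    refine ⟨a, ?_, ?_⟩
    · rwa [List.getElem?_append_left hpn] at h1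
    · rwa [List.getElem?_take_of_lt (hlt p hp hpn)]
  · intro p hp q hq
    exact h.monotone p (Finset.mem_filter.1 hp).1 q (Finset.mem_filter.1 hq).1
  · intro p hp
    obtain ⟨r, hr, rfl⟩ := Finset.mem_image.1 hp
    obtain ⟨hr, hrn⟩ := Finset.mem_filter.1 hr
    obtain ⟨a, h1, h2⟩ := h.eq_letters r hr
    have := hge r hr hrn
    refine ⟨a, ?_, ?_⟩
    · rwa [List.getElem?_append_right hrn] at h1
    · rw [List.getElem?_drop]
      simpa [Nat.add_sub_cancel' this] using h2
  · intro p hp q hq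
    obtain ⟨r, hr, rfl⟩ := Finset.mem_image.1 hp
    obtain ⟨hr, hrn⟩ := Finset.mem_filter.1 hr
    obtain ⟨r', hr', rfl⟩ := Finset.mem_image.1 hq
    obtain ⟨hr', hrn'⟩ := Finset.mem_filter.1 hr'
    have h1 := hge r hr hrn
    have h2 := hge r' hr' hrn'
    have h3 := h.monotone r hr r' hr'
    simp only
    omega
  · intro P _
    rw [Finset.filter_image, Finset.card_image_of_injOn (hinj.mono ?_), Finset.filter_filter]
    intro p hp
    exact (Finset.mem_filter.1 hp).1

theorem IsAlignment.card_le {x y : List A} : ∀ {π : Finset (ℕ × ℕ)}, IsAlignment x y π →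
    π.card ≤ lcsLen x y := by
  induction x generalizing y with
  | nil =>
    intro π h
    rw [Finset.card_eq_zero.2 (Finset.eq_empty_of_forall_notMem fun p hp => ?_)]
    · exact Nat.zero_le _
    · obtain ⟨a, h1, -⟩ := h.eq_letters p hp
      simp at h1
  | cons a x ih =>
    intro π h
    obtain ⟨y₁, y₂, π₂, rfl, h1, h2, hc⟩ := IsAlignment.exists_split (x₁ := [a]) (x₂ := x) h
    have hcard : π.card = (π.filter (fun p => p.1 < [a].length)).card + π₂.card := by
      have := hc (fun _ => True)
      simp only [Finset.filter_true, and_true] at this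
      rw [this, ← Finset.card_filter_add_card_filter_not (fun p : ℕ × ℕ => p.1 < [a].length)]
      simp only [not_lt]
    have hle : (π.filter (fun p => p.1 < [a].length)).card ≤ lcsLen [a] y₁ := by
      rcases Finset.eq_empty_or_nonempty (π.filter (fun p => p.1 < [a].length)) with he | ⟨p, hp⟩
      · rw [he, Finset.card_empty]
        exact Nat.zero_le _
      · have h01 : (π.filter (fun p => p.1 < [a].length)).card ≤ 1 := by
          refine Finset.card_le_one.2 fun q hq r hr => ?_
          have hq1 := (Finset.mem_filter.1 hq).2
          have hr1 := (Finset.mem_filter.1 hr).2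
          have hm := h1.monotone q hq r hr
          have hm' := h1.monotone r hr q hq
          simp only [List.length_cons, List.length_nil] at hq1 hr1
          ext <;> omega
        refine h01.trans ?_
        obtain ⟨b, hb1, hb2⟩ := h1.eq_letters p hp
        have hp1 := (Finset.mem_filter.1 hp).2
        have hp0 : p.1 = 0 := by simpa using hp1
        rw [hp0] at hb1
        simp only [List.getElem?_cons_zero, Option.some.injEq] at hb1
        subst hb1
        exact length_le_lcsLen (w := [a]) (List.Sublist.refl _)
          (List.singleton_sublist.2 (List.mem_of_getElem? hb2))
    have := add_lcsLen_le [a] x y₁ y₂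
    have := ih h2
    simp only [List.cons_append, List.nil_append] at *
    omega

/-- The score of an alignment of `x₁ ++ c ⋯ c ++ x₂` with `y` splits into the scores left and
right of the block and the number of aligned block letters; the latter is at most the number of
occurrences of `c` in the segment of `y` that faces the block. -/
theorem IsAlignment.exists_split_block [DecidableEq A] {x₁ x₂ y : List A} {n : ℕ} {c : A}
    {π : Finset (ℕ × ℕ)} (h : IsAlignment (x₁ ++ (List.replicate n c ++ x₂)) y π) :
    ∃ y₁ y₂ y₃ : List A, y = y₁ ++ (y₂ ++ y₃) ∧
      π.card ≤ lcsLen x₁ y₁ +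
        (π.filter (fun p => x₁.length ≤ p.1 ∧ p.1 < x₁.length + n)).card + lcsLen x₂ y₃ ∧
      (π.filter (fun p => x₁.length ≤ p.1 ∧ p.1 < x₁.length + n)).card ≤ y₂.count c := by
  obtain ⟨y₁, y', π', rfl, h1, h', hc⟩ := h.exists_split
  obtain ⟨y₂, y₃, π₃, rfl, h2, h3, hc'⟩ := h'.exists_split
  have e1 := hc (fun _ => True)
  have e2 := hc' (fun _ => True)
  have e3 := hc (fun i => i < (List.replicate n c).length)
  simp only [Finset.filter_true, and_true, List.length_replicate] at e1 e2 e3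
  have e4 : (π.filter (fun p => x₁.length ≤ p.1 ∧ p.1 - x₁.length < n)) =
      π.filter (fun p => x₁.length ≤ p.1 ∧ p.1 < x₁.length + n) :=
    Finset.filter_congr fun p _ => by omega
  rw [e4] at e3
  have c1 := Finset.card_filter_add_card_filter_not (s := π) (fun p : ℕ × ℕ => p.1 < x₁.length)
  have c2 := Finset.card_filter_add_card_filter_not (s := π') (fun p : ℕ × ℕ => p.1 < n)
  simp only [not_lt] at c1 c2
  have l1 := h1.card_le
  have l2 := h2.card_le
  have l3 := h3.card_le
  simp only [List.length_replicate] at l2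
  have l4 := lcsLen_replicate_le n c y₂
  exact ⟨y₁, y₂, y₃, rfl, by omega, by omega⟩

end Alignment

/-! ### Averages over uniform strings -/

section Avg

variable {k : ℕ}

/-- The expectation of `g` at a string of `n` iid letters, uniform on `k` letters, as an iterated
average over the letters. -/
noncomputable def avg : ℕ → (List (Fin k) → ℝ) → ℝ
  | 0, g => g []
  | n + 1, g => (∑ a : Fin k, avg n (fun l => g (a :: l))) / k

theorem avg_mono {n : ℕ} : ∀ {g h : List (Fin k) → ℝ}, (∀ l, l.length = n → g l ≤ h l) →
    avg n g ≤ avg n h := by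
  induction n with
  | zero => intro g h H; exact H [] rfl
  | succ n ih =>
    intro g h H
    simp only [avg]
    refine div_le_div_of_nonneg_right (Finset.sum_le_sum fun a _ => ih fun l hl => ?_)
      (Nat.cast_nonneg k)
    exact H _ (by simp [hl])

theorem avg_congr {n : ℕ} {g h : List (Fin k) → ℝ} (H : ∀ l, l.length = n → g l = h l) :
    avg n g = avg n h :=
  le_antisymm (avg_mono fun l hl => (H l hl).le) (avg_mono fun l hl => (H l hl).ge)

theorem avg_add (n : ℕ) : ∀ g h : List (Fin k) → ℝ,
    avg n (fun l => g l + h l) = avg n g + avg n h := by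
  induction n with
  | zero => intro g h; rfl
  | succ n ih => intro g h; simp only [avg, ih, Finset.sum_add_distrib, add_div]

theorem avg_mul_left (n : ℕ) (c : ℝ) : ∀ g : List (Fin k) → ℝ,
    avg n (fun l => c * g l) = c * avg n g := by
  induction n with
  | zero => intro g; rfl
  | succ n ih => intro g; simp only [avg, ih, ← Finset.mul_sum, mul_div_assoc]

theorem avg_neg (n : ℕ) (g : List (Fin k) → ℝ) : avg n (fun l => -g l) = -avg n g := by
  simpa using avg_mul_left n (-1) g

theorem avg_const [NeZero k] (n : ℕ) (c : ℝ) : avg n (fun _ : List (Fin k) => c) = c := by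
  induction n with
  | zero => rfl
  | succ n ih =>
    have : (k : ℝ) ≠ 0 := Nat.cast_ne_zero.2 (NeZero.ne k)
    simp only [avg, ih, Finset.sum_const, Finset.card_univ, Fintype.card_fin, nsmul_eq_mul]
    field_simp

theorem avg_sum {ι : Type*} (n : ℕ) (s : Finset ι) : ∀ g : ι → List (Fin k) → ℝ,
    avg n (fun l => ∑ i ∈ s, g i l) = ∑ i ∈ s, avg n (g i) := by
  induction n with
  | zero => intro g; rfl
  | succ n ih =>
    intro g
    simp only [avg, ih]
    rw [Finset.sum_comm, Finset.sum_div]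

theorem avg_append (m n : ℕ) : ∀ g : List (Fin k) → ℝ,
    avg (m + n) g = avg m (fun x => avg n (fun y => g (x ++ y))) := by
  induction m with
  | zero => intro g; simp [avg]
  | succ m ih => intro g; rw [Nat.succ_add]; simp only [avg, ih, List.cons_append]

theorem avg_take [NeZero k] {n i : ℕ} (h : i ≤ n) (g : List (Fin k) → ℝ) :
    avg n (fun l => g (l.take i)) = avg i g := by
  obtain ⟨r, rfl⟩ := Nat.exists_eq_add_of_le h
  rw [avg_append]
  refine avg_congr fun x hx => ?_
  rw [avg_congr (h := fun _ => g x), avg_const]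
  intro y _
  rw [← hx, List.take_left]

theorem avg_drop [NeZero k] {n i : ℕ} (h : i ≤ n) (g : List (Fin k) → ℝ) :
    avg n (fun l => g (l.drop i)) = avg (n - i) g := by
  obtain ⟨r, rfl⟩ := Nat.exists_eq_add_of_le h
  rw [avg_append, avg_congr (h := fun _ => avg r g), avg_const, Nat.add_sub_cancel_left]
  intro x hx
  refine avg_congr fun y _ => ?_
  rw [← hx, List.drop_left]

theorem avg_window [NeZero k] {n i s : ℕ} (h : i + s ≤ n) (g : List (Fin k) → ℝ) :
    avg n (fun l => g ((l.drop i).take s)) = avg s g := by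
  rw [avg_drop (by omega) (fun l => g (l.take s)), avg_take (by omega)]

theorem avg_cut [NeZero k] {n i s : ℕ} (h : i + s ≤ n) (g : List (Fin k) → ℝ) :
    avg n (fun l => g (l.take i ++ l.drop (i + s))) = avg (n - s) g := by
  obtain ⟨r, rfl⟩ := Nat.exists_eq_add_of_le h
  have e : i + s + r - s = i + r := by omega
  rw [e, add_assoc, avg_append, avg_append]
  refine avg_congr fun x hx => ?_
  have hd := avg_drop (n := s + r) (i := s) (by omega) (fun y => g (x ++ y))
  rw [Nat.add_sub_cancel_left] at hd
  rw [← hd]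
  refine avg_congr fun y _ => ?_
  rw [← hx, List.take_left, List.drop_append, List.drop_of_length_le (by omega),
    Nat.add_sub_cancel_left, List.nil_append]

theorem avg_eq_sum [NeZero k] (n : ℕ) : ∀ g : List (Fin k) → ℝ,
    avg n g = (∑ v : Fin n → Fin k, g (List.ofFn v)) / (k : ℝ) ^ n := by
  induction n with
  | zero => intro g; simp [avg]
  | succ n ih =>
    intro g
    have hs : ∑ v : Fin (n + 1) → Fin k, g (List.ofFn v) =
        ∑ a : Fin k, ∑ v : Fin n → Fin k, g (a :: List.ofFn v) := by
      rw [← Fintype.sum_prod_type', ← (Fin.consEquiv (fun _ => Fin k)).sum_comp]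
      refine Finset.sum_congr rfl fun p _ => ?_
      simp [Fin.consEquiv, List.ofFn_succ]
    simp only [avg, ih, hs, ← Finset.sum_div]
    rw [div_div, pow_succ]

end Avg

/-! ### Concentration of Lipschitz functionals -/

section Concentration

variable {k : ℕ}

/-- Changing one letter of a string of length `n` changes `G` by at most one. -/
def IsLetterLipschitz (n : ℕ) (G : List (Fin k) → ℝ) : Prop :=
  ∀ (l₁ l₂ : List (Fin k)) (a b : Fin k), l₁.length + 1 + l₂.length = n →
    G (l₁ ++ a :: l₂) ≤ G (l₁ ++ b :: l₂) + 1

theorem IsLetterLipschitz.neg {n : ℕ} {G : List (Fin k) → ℝ} (h : IsLetterLipschitz n G) :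
    IsLetterLipschitz n (fun l => -G l) := fun l₁ l₂ a b hl => by
  have := h l₁ l₂ b a hl
  linarith

/-- Hoeffding's lemma for a finite average of centred numbers in `[-1, 1]`. -/
theorem sum_exp_mul_le {ι : Type*} (s : Finset ι) (z : ι → ℝ) (h0 : ∑ i ∈ s, z i = 0)
    (h1 : ∀ i ∈ s, |z i| ≤ 1) (t : ℝ) :
    ∑ i ∈ s, Real.exp (t * z i) ≤ s.card * Real.exp (t ^ 2 / 2) := by
  calc ∑ i ∈ s, Real.exp (t * z i) ≤ ∑ i ∈ s, (Real.cosh t + z i * Real.sinh t) :=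
        Finset.sum_le_sum fun i hi => by
          have := Real.exp_mul_le_cosh_add_mul_sinh (h1 i hi) t
          rwa [mul_comm] at this
    _ = s.card * Real.cosh t := by
        rw [Finset.sum_add_distrib, ← Finset.sum_mul, h0]; simp
    _ ≤ s.card * Real.exp (t ^ 2 / 2) :=
        mul_le_mul_of_nonneg_left (Real.cosh_le_exp_half_sq t) (Nat.cast_nonneg _)

/-- The bounded differences inequality, by conditioning on the first letter. -/
theorem avg_exp_le [NeZero k] (t : ℝ) (n : ℕ) : ∀ {G : List (Fin k) → ℝ},
    IsLetterLipschitz n G →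
    avg n (fun l => Real.exp (t * (G l - avg n G))) ≤ Real.exp (n * (t ^ 2 / 2)) := by
  have hk : (0 : ℝ) < k := Nat.cast_pos.2 (Nat.pos_of_ne_zero (NeZero.ne k))
  induction n with
  | zero => intro G _; simp [avg]
  | succ n ih =>
    intro G hG
    set M : ℝ := avg (n + 1) G with hM
    set m : Fin k → ℝ := fun a => avg n (fun l => G (a :: l)) with hm
    have hMm : M = (∑ a, m a) / k := rfl
    have hab : ∀ a b, m a ≤ m b + 1 := by
      intro a b
      have h1 : m b + 1 = avg n (fun l => G (b :: l) + 1) := by rw [avg_add, avg_const]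
      rw [h1]
      exact avg_mono fun l hl => hG [] l a b (by simp [hl, add_comm])
    have hz0 : ∑ a, (m a - M) = 0 := by
      rw [Finset.sum_sub_distrib, hMm]
      simp only [Finset.sum_const, Finset.card_univ, Fintype.card_fin, nsmul_eq_mul]
      field_simp
      ring
    have hz1 : ∀ a ∈ Finset.univ, |m a - M| ≤ 1 := by
      intro a _
      have hu : M ≤ m a + 1 := by
        rw [hMm, div_le_iff₀ hk]
        calc ∑ b, m b ≤ ∑ _b : Fin k, (m a + 1) := Finset.sum_le_sum fun b _ => hab b a
          _ = (m a + 1) * k := by simp; ring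
      have hl : m a - 1 ≤ M := by
        rw [hMm, le_div_iff₀ hk]
        calc (m a - 1) * k = ∑ _b : Fin k, (m a - 1) := by simp; ring
          _ ≤ ∑ b, m b := Finset.sum_le_sum fun b _ => by linarith [hab a b]
      rw [abs_le]; constructor <;> linarith
    have hstep : ∀ a, avg n (fun l => Real.exp (t * (G (a :: l) - M))) ≤
        Real.exp (n * (t ^ 2 / 2)) * Real.exp (t * (m a - M)) := by
      intro a
      have hL : IsLetterLipschitz n (fun l => G (a :: l)) := fun l₁ l₂ b c hl =>
        hG (a :: l₁) l₂ b c (by simp only [List.length_cons]; omega)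
      calc avg n (fun l => Real.exp (t * (G (a :: l) - M)))
          = Real.exp (t * (m a - M)) * avg n (fun l => Real.exp (t * (G (a :: l) - m a))) := by
            rw [← avg_mul_left]
            refine avg_congr fun l _ => ?_
            rw [← Real.exp_add]; congr 1; ring
        _ ≤ Real.exp (t * (m a - M)) * Real.exp (n * (t ^ 2 / 2)) :=
            mul_le_mul_of_nonneg_left (ih hL) (Real.exp_pos _).le
        _ = _ := mul_comm _ _
    have hfin := sum_exp_mul_le Finset.univ (fun a => m a - M) hz0 hz1 t
    simp only [Finset.card_univ, Fintype.card_fin] at hfin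
    calc (∑ a, avg n (fun l => Real.exp (t * (G (a :: l) - M)))) / k
        ≤ (∑ a, Real.exp (n * (t ^ 2 / 2)) * Real.exp (t * (m a - M))) / k :=
          div_le_div_of_nonneg_right (Finset.sum_le_sum fun a _ => hstep a) hk.le
      _ ≤ (Real.exp (n * (t ^ 2 / 2)) * (k * Real.exp (t ^ 2 / 2))) / k := by
          rw [← Finset.mul_sum]
          exact div_le_div_of_nonneg_right
            (mul_le_mul_of_nonneg_left hfin (Real.exp_pos _).le) hk.le
      _ = Real.exp (((n + 1 : ℕ) : ℝ) * (t ^ 2 / 2)) := by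
          push_cast
          rw [add_mul, one_mul, Real.exp_add]
          field_simp

open Classical in
theorem avg_deviation_le [NeZero k] {n N : ℕ} (hN : 0 < N) (hn : n ≤ N) {G : List (Fin k) → ℝ}
    (hG : IsLetterLipschitz n G) {r : ℝ} (hr : 0 ≤ r) :
    avg n (fun l => if avg n G + r ≤ G l then 1 else 0) ≤ Real.exp (-(r ^ 2 / (2 * N))) := by
  have hN' : (0 : ℝ) < N := Nat.cast_pos.2 hN
  set t : ℝ := r / N with ht
  have ht0 : 0 ≤ t := by positivity
  calc avg n (fun l => if avg n G + r ≤ G l then 1 else 0)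
      ≤ avg n (fun l => Real.exp (-(t * r)) * Real.exp (t * (G l - avg n G))) := by
        refine avg_mono fun l _ => ?_
        split_ifs with h
        · rw [← Real.exp_add]
          refine Real.one_le_exp ?_
          have : t * r ≤ t * (G l - avg n G) := mul_le_mul_of_nonneg_left (by linarith) ht0
          linarith
        · positivity
    _ ≤ Real.exp (-(t * r)) * Real.exp (n * (t ^ 2 / 2)) := by
        rw [avg_mul_left]
        exact mul_le_mul_of_nonneg_left (avg_exp_le t n hG) (Real.exp_pos _).le
    _ ≤ Real.exp (-(t * r)) * Real.exp (N * (t ^ 2 / 2)) := by gcongr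
    _ = Real.exp (-(r ^ 2 / (2 * N))) := by
        rw [← Real.exp_add, ht]
        congr 1
        field_simp
        ring

end Concentration

/-! ### Probabilities for pairs of uniform strings -/

section Prob

variable {k : ℕ}

open Classical in
/-- The probability of `P` at two independent uniform strings of lengths `m` and `n`. -/
noncomputable def prob (m n : ℕ) (P : List (Fin k) → List (Fin k) → Prop) : ℝ :=
  avg m (fun x => avg n (fun y => if P x y then 1 else 0))

theorem prob_mono {m n : ℕ} {P Q : List (Fin k) → List (Fin k) → Prop}
    (h : ∀ x y, x.length = m → y.length = n → P x y → Q x y) : prob m n P ≤ prob m n Q := by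
  refine avg_mono fun x hx => avg_mono fun y hy => ?_
  by_cases hP : P x y
  · simp [hP, h x y hx hy hP]
  · simp only [hP, if_false]; split_ifs <;> norm_num

theorem prob_compl [NeZero k] (m n : ℕ) (P : List (Fin k) → List (Fin k) → Prop) :
    prob m n P = 1 - prob m n (fun x y => ¬ P x y) := by
  rw [eq_sub_iff_add_eq, prob, prob, ← avg_add]
  refine Eq.trans (avg_congr fun x _ => ?_) (avg_const m 1)
  rw [← avg_add]
  refine Eq.trans (avg_congr fun y _ => ?_) (avg_const n 1)
  by_cases h : P x y <;> simp [h]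

theorem prob_or_le (m n : ℕ) (P Q : List (Fin k) → List (Fin k) → Prop) :
    prob m n (fun x y => P x y ∨ Q x y) ≤ prob m n P + prob m n Q := by
  rw [prob, prob, prob, ← avg_add]
  refine avg_mono fun x _ => ?_
  rw [← avg_add]
  refine avg_mono fun y _ => ?_
  by_cases h : P x y <;> by_cases h' : Q x y <;> simp [h, h']

theorem prob_exists_le {ι : Type*} (m n : ℕ) (s : Finset ι)
    (P : ι → List (Fin k) → List (Fin k) → Prop) {p : ℝ} (hp : ∀ i ∈ s, prob m n (P i) ≤ p) :
    prob m n (fun x y => ∃ i ∈ s, P i x y) ≤ s.card * p := by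
  classical
  calc prob m n (fun x y => ∃ i ∈ s, P i x y) ≤ ∑ i ∈ s, prob m n (P i) := by
        simp only [prob]
        rw [← avg_sum]
        refine avg_mono fun x _ => ?_
        rw [← avg_sum]
        refine avg_mono fun y _ => ?_
        have hnn : ∀ j ∈ s, (0 : ℝ) ≤ if P j x y then 1 else 0 := fun j _ => by
          split_ifs <;> norm_num
        by_cases h : ∃ i ∈ s, P i x y
        · obtain ⟨i, hi, hPi⟩ := h
          rw [if_pos ⟨i, hi, hPi⟩]
          calc (1 : ℝ) = if P i x y then 1 else 0 := by rw [if_pos hPi]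
            _ ≤ _ := Finset.single_le_sum (f := fun j => if P j x y then (1 : ℝ) else 0) hnn hi
        · rw [if_neg h]
          exact Finset.sum_nonneg hnn
    _ ≤ s.card * p := by
        rw [← nsmul_eq_mul]
        exact Finset.sum_le_card_nsmul _ _ _ hp

/-- An event of probability less than one fails somewhere. -/
theorem exists_of_prob_lt_one [NeZero k] {m n : ℕ} {P : List (Fin k) → List (Fin k) → Prop}
    (h : prob m n P < 1) : ∃ x y, x.length = m ∧ y.length = n ∧ ¬ P x y := by
  by_contra! H
  have h1 : prob m n (fun _ _ : List (Fin k) => True) ≤ prob m n P :=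
    prob_mono fun x y hx hy _ => H x y hx hy
  have h2 : prob m n (fun _ _ : List (Fin k) => True) = 1 := by
    simp only [prob, if_true, avg_const]
  linarith

theorem prob_eq_sum [NeZero k] (m n : ℕ) (P : List (Fin k) → List (Fin k) → Prop)
    [∀ x y, Decidable (P x y)] :
    prob m n P = (∑ x : Fin m → Fin k, ∑ y : Fin n → Fin k,
      if P (List.ofFn x) (List.ofFn y) then (1 : ℝ) else 0) / (k : ℝ) ^ (m + n) := by
  simp only [prob, avg_eq_sum, ← Finset.sum_div]
  rw [div_div, ← pow_add, add_comm n m]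
  congr 1
  refine Finset.sum_congr rfl fun x _ => Finset.sum_congr rfl fun y _ => ?_
  congr

theorem inv_pow_le_prob [NeZero k] {m n : ℕ} {P : List (Fin k) → List (Fin k) → Prop}
    (x : Fin m → Fin k) (y : Fin n → Fin k) (h : P (List.ofFn x) (List.ofFn y)) :
    1 / (k : ℝ) ^ (m + n) ≤ prob m n P := by
  classical
  rw [prob_eq_sum]
  refine div_le_div_of_nonneg_right ?_ (by positivity)
  have hnn : ∀ (x : Fin m → Fin k) (y : Fin n → Fin k),
      (0 : ℝ) ≤ if P (List.ofFn x) (List.ofFn y) then 1 else 0 := fun x y => by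
    split_ifs <;> norm_num
  calc (1 : ℝ) = if P (List.ofFn x) (List.ofFn y) then 1 else 0 := by rw [if_pos h]
    _ ≤ ∑ y : Fin n → Fin k, if P (List.ofFn x) (List.ofFn y) then (1 : ℝ) else 0 :=
        Finset.single_le_sum (f := fun y => if P (List.ofFn x) (List.ofFn y) then (1 : ℝ) else 0)
          (fun y _ => hnn x y) (Finset.mem_univ y)
    _ ≤ _ := Finset.single_le_sum (f := fun x : Fin m → Fin k => ∑ y : Fin n → Fin k,
          if P (List.ofFn x) (List.ofFn y) then (1 : ℝ) else 0)
          (fun x _ => Finset.sum_nonneg fun y _ => hnn x y) (Finset.mem_univ x)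

end Prob

/-! ### The mean LCS length -/

section MeanLcs

variable {k : ℕ}

theorem meanLcs_comm (m n : ℕ) : meanLcs k m n = meanLcs k n m := by
  simp only [meanLcs, lcsLen_comm, add_comm n m]
  rw [Finset.sum_comm]

theorem meanLcs_nonneg (m n : ℕ) : 0 ≤ meanLcs k m n :=
  div_nonneg (Finset.sum_nonneg fun _ _ => Finset.sum_nonneg fun _ _ => Nat.cast_nonneg _)
    (by positivity)

theorem isLetterLipschitz_lcsLen (m n : ℕ) :
    IsLetterLipschitz (m + n) (fun z : List (Fin k) => (lcsLen (z.take m) (z.drop m) : ℝ)) := by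
  intro l₁ l₂ a b hl
  rcases lt_or_ge l₁.length m with h | h
  · obtain ⟨r, rfl⟩ := Nat.exists_eq_add_of_le' (Nat.succ_le_of_lt h)
    have e : r + (l₁.length + 1) - l₁.length = r + 1 := by omega
    simp only [List.take_append, List.drop_append, Nat.succ_eq_add_one, e, List.take_succ_cons,
      List.drop_succ_cons]
    rw [List.take_of_length_le (show l₁.length ≤ r + (l₁.length + 1) by omega)]
    exact_mod_cast lcsLen_subst_left_le _ _ _ _ _
  · simp only [List.take_append_of_le_length h, List.drop_append_of_le_length h]
    exact_mod_cast lcsLen_subst_right_le _ _ _ _ _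

variable [NeZero k]

theorem meanLcs_eq_avg (m n : ℕ) :
    meanLcs k m n = avg m (fun x : List (Fin k) => avg n (fun y => (lcsLen x y : ℝ))) := by
  simp only [meanLcs, avg_eq_sum, ← Finset.sum_div]
  rw [div_div, ← pow_add, add_comm n m]

theorem meanLcs_le_left (m n : ℕ) : meanLcs k m n ≤ m := by
  rw [meanLcs_eq_avg, ← avg_const (k := k) m m]
  refine avg_mono fun x hx => ?_
  rw [← avg_const (k := k) n (m : ℝ)]
  refine avg_mono fun y _ => ?_
  exact_mod_cast hx ▸ lcsLen_le_length_left x y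

theorem meanLcs_add_le (m m' n n' : ℕ) :
    meanLcs k m n + meanLcs k m' n' ≤ meanLcs k (m + m') (n + n') := by
  simp only [meanLcs_eq_avg]
  rw [avg_append m m']
  calc avg m (fun x : List (Fin k) => avg n (fun y => (lcsLen x y : ℝ))) +
        avg m' (fun x' : List (Fin k) => avg n' (fun y' => (lcsLen x' y' : ℝ)))
      = avg m (fun x : List (Fin k) => avg m' (fun x' : List (Fin k) =>
          avg n (fun y => avg n' (fun y' => (lcsLen x y : ℝ) + (lcsLen x' y' : ℝ))))) := by
        simp only [avg_add, avg_const]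
    _ ≤ _ := by
        refine avg_mono fun x _ => avg_mono fun x' _ => ?_
        rw [avg_append]
        refine avg_mono fun y _ => avg_mono fun y' _ => ?_
        exact_mod_cast add_lcsLen_le x x' y y'

theorem meanLcs_mono {m m' n n' : ℕ} (hm : m ≤ m') (hn : n ≤ n') :
    meanLcs k m n ≤ meanLcs k m' n' := by
  have := meanLcs_add_le (k := k) m (m' - m) n (n' - n)
  rw [Nat.add_sub_cancel' hm, Nat.add_sub_cancel' hn] at this
  linarith [meanLcs_nonneg (k := k) (m' - m) (n' - n)]

theorem meanLcs_add_left_le (m j n : ℕ) : meanLcs k (m + j) n ≤ meanLcs k m n + j := by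
  simp only [meanLcs_eq_avg]
  rw [avg_append]
  calc _ ≤ avg m (fun x : List (Fin k) => avg j (fun _ : List (Fin k) =>
          avg n (fun y => (lcsLen x y : ℝ) + (j : ℝ)))) := by
        refine avg_mono fun x _ => avg_mono fun x' hx' => avg_mono fun y _ => ?_
        exact_mod_cast hx' ▸ lcsLen_append_left_le x x' y
    _ = _ := by simp only [avg_add, avg_const]

theorem meanLcs_add_right_le (m n j : ℕ) : meanLcs k m (n + j) ≤ meanLcs k m n + j := by
  rw [meanLcs_comm, meanLcs_comm m n]
  exact meanLcs_add_left_le n j m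

theorem avg_lcsLen_take_drop (m n : ℕ) :
    avg (m + n) (fun z : List (Fin k) => (lcsLen (z.take m) (z.drop m) : ℝ)) =
      meanLcs k m n := by
  rw [meanLcs_eq_avg, avg_append]
  refine avg_congr fun x hx => avg_congr fun y _ => ?_
  rw [← hx, List.take_left, List.drop_left]

theorem prob_meanLcs_add_le {m n N : ℕ} (hN : 0 < N) (h : m + n ≤ N) {r : ℝ} (hr : 0 ≤ r) :
    prob m n (fun x y : List (Fin k) => meanLcs k m n + r ≤ lcsLen x y) ≤
      Real.exp (-(r ^ 2 / (2 * N))) := by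
  classical
  refine le_trans (le_of_eq ?_) (avg_deviation_le hN h (isLetterLipschitz_lcsLen (k := k) m n) hr)
  rw [avg_lcsLen_take_drop, avg_append, prob]
  refine avg_congr fun x hx => avg_congr fun y _ => ?_
  rw [← hx, List.take_left, List.drop_left]

theorem prob_le_meanLcs_sub {m n N : ℕ} (hN : 0 < N) (h : m + n ≤ N) {r : ℝ} (hr : 0 ≤ r) :
    prob m n (fun x y : List (Fin k) => (lcsLen x y : ℝ) ≤ meanLcs k m n - r) ≤
      Real.exp (-(r ^ 2 / (2 * N))) := by
  classical
  refine le_trans (le_of_eq ?_)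
    (avg_deviation_le hN h (isLetterLipschitz_lcsLen (k := k) m n).neg hr)
  rw [avg_neg, avg_lcsLen_take_drop, avg_append, prob]
  refine avg_congr fun x hx => avg_congr fun y _ => ?_
  rw [← hx, List.take_left, List.drop_left]
  congr 1
  rw [eq_iff_iff]
  constructor <;> intro h <;> linarith

/-- The number of occurrences of a letter has mean `n / k`. -/
theorem avg_count (c : Fin k) (n : ℕ) :
    avg n (fun l : List (Fin k) => (l.count c : ℝ)) = n / k := by
  induction n with
  | zero => simp [avg]
  | succ n ih =>
    have hk : (k : ℝ) ≠ 0 := Nat.cast_ne_zero.2 (NeZero.ne k)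
    have : ∀ a : Fin k, avg n (fun l => ((a :: l).count c : ℝ)) =
        (n : ℝ) / k + if a = c then 1 else 0 := by
      intro a
      rw [← ih, ← avg_const (k := k) n (if a = c then (1 : ℝ) else 0), ← avg_add]
      refine avg_congr fun l _ => ?_
      rw [List.count_cons]
      by_cases h : a = c <;> simp [h]
    simp only [avg, this, Finset.sum_add_distrib, Finset.sum_const, Finset.card_univ,
      Fintype.card_fin, nsmul_eq_mul, Finset.sum_ite_eq', Finset.mem_univ, if_true]
    push_cast
    field_simp

open Classical in
theorem avg_count_deviation_le {n N : ℕ} (hN : 0 < N) (h : n ≤ N) (c : Fin k) {r : ℝ}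
    (hr : 0 ≤ r) :
    avg n (fun l : List (Fin k) => if (n : ℝ) / k + r ≤ l.count c then 1 else 0) ≤
      Real.exp (-(r ^ 2 / (2 * N))) := by
  rw [← avg_count c n]
  refine avg_deviation_le hN h ?_ hr
  intro l₁ l₂ a b _
  simp only [List.count_append, List.count_cons]
  push_cast
  by_cases ha : a = c <;> by_cases hb : b = c <;> simp [ha, hb, add_assoc]

end MeanLcs

/-! ### The shape function -/

section Shape

variable {k : ℕ}

/-- The asymptotic mean LCS length of strings of lengths proportional to `x` and `y`. -/
noncomputable def shape (k : ℕ) (x y : ℝ) : ℝ :=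
  limUnder atTop (fun n : ℕ => meanLcs k ⌊n * x⌋₊ ⌊n * y⌋₊ / n)

theorem shape_comm {x y : ℝ} : shape k x y = shape k y x := by
  simp only [shape, meanLcs_comm (k := k) ⌊_ * x⌋₊]

variable [NeZero k]

theorem meanLcs_le_add_abs (a b a' b' : ℕ) :
    meanLcs k a b ≤ meanLcs k a' b' + |(a : ℝ) - a'| + |(b : ℝ) - b'| := by
  have h1 : meanLcs k a b ≤ meanLcs k (a' + (a - a')) (b' + (b - b')) :=
    meanLcs_mono (by omega) (by omega)
  have h2 := meanLcs_add_left_le (k := k) a' (a - a') (b' + (b - b'))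
  have h3 := meanLcs_add_right_le (k := k) a' b' (b - b')
  have aux : ∀ u v : ℕ, ((u - v : ℕ) : ℝ) ≤ |(u : ℝ) - v| := by
    intro u v
    rcases le_total v u with h | h
    · rw [Nat.cast_sub h]; exact le_abs_self _
    · rw [Nat.sub_eq_zero_of_le h]; simp
  have := aux a a'
  have := aux b b'
  linarith

theorem abs_meanLcs_sub_le (a b a' b' : ℕ) :
    |meanLcs k a b - meanLcs k a' b'| ≤ |(a : ℝ) - a'| + |(b : ℝ) - b'| := by
  have h1 := meanLcs_le_add_abs (k := k) a b a' b'
  have h2 := meanLcs_le_add_abs (k := k) a' b' a b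
  rw [abs_sub_comm (a' : ℝ), abs_sub_comm (b' : ℝ)] at h2
  rw [abs_le]
  constructor <;> linarith

theorem subadditive_neg_meanLcs {x y : ℝ} (hx : 0 ≤ x) (hy : 0 ≤ y) :
    Subadditive (fun n : ℕ => -meanLcs k ⌊n * x⌋₊ ⌊n * y⌋₊) := by
  intro m n
  have h1 := meanLcs_add_le (k := k) ⌊m * x⌋₊ ⌊n * x⌋₊ ⌊m * y⌋₊ ⌊n * y⌋₊
  have aux : ∀ {z : ℝ}, 0 ≤ z → ⌊m * z⌋₊ + ⌊n * z⌋₊ ≤ ⌊((m + n : ℕ) : ℝ) * z⌋₊ := by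
    intro z hz
    refine Nat.le_floor ?_
    push_cast
    have h1 := Nat.floor_le (show (0 : ℝ) ≤ m * z by positivity)
    have h2 := Nat.floor_le (show (0 : ℝ) ≤ n * z by positivity)
    linarith
  have h2 := meanLcs_mono (k := k) (aux hx) (aux hy)
  linarith

theorem bddBelow_neg_meanLcs {x y : ℝ} (hx : 0 ≤ x) :
    BddBelow (Set.range fun n : ℕ => -meanLcs k ⌊n * x⌋₊ ⌊n * y⌋₊ / n) := by
  refine ⟨-x, ?_⟩
  rintro _ ⟨n, rfl⟩
  rcases Nat.eq_zero_or_pos n with rfl | hn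
  · simpa using hx
  · have hn' : (0 : ℝ) < n := Nat.cast_pos.2 hn
    rw [le_div_iff₀ hn']
    have h1 := meanLcs_le_left (k := k) ⌊n * x⌋₊ ⌊n * y⌋₊
    have h2 := Nat.floor_le (show (0 : ℝ) ≤ n * x by positivity)
    linarith

theorem tendsto_neg_lim {x y : ℝ} (hx : 0 ≤ x) (hy : 0 ≤ y) :
    Tendsto (fun n : ℕ => meanLcs k ⌊n * x⌋₊ ⌊n * y⌋₊ / n) atTop
      (𝓝 (-(subadditive_neg_meanLcs (k := k) hx hy).lim)) := by
  have := ((subadditive_neg_meanLcs (k := k) hx hy).tendsto_lim (bddBelow_neg_meanLcs hx)).neg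
  refine this.congr fun n => ?_
  rw [neg_div, neg_neg]

theorem tendsto_shape {x y : ℝ} (hx : 0 ≤ x) (hy : 0 ≤ y) :
    Tendsto (fun n : ℕ => meanLcs k ⌊n * x⌋₊ ⌊n * y⌋₊ / n) atTop (𝓝 (shape k x y)) := by
  have := tendsto_neg_lim (k := k) hx hy
  rwa [shape, this.limUnder_eq]

/-- By superadditivity the limit dominates the means. -/
theorem meanLcs_le_shape (m n : ℕ) : meanLcs k m n ≤ shape k m n := by
  have hm : (0 : ℝ) ≤ m := Nat.cast_nonneg m
  have hn : (0 : ℝ) ≤ n := Nat.cast_nonneg n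
  rw [shape, (tendsto_neg_lim (k := k) hm hn).limUnder_eq]
  have := (subadditive_neg_meanLcs (k := k) hm hn).lim_le_div (bddBelow_neg_meanLcs hm)
    one_ne_zero
  simp only [Nat.cast_one, one_mul, Nat.floor_natCast, div_one] at this
  linarith

/-- Bounded perturbations of the lengths do not change the limit. -/
theorem tendsto_shape_of_abs_sub_le {x y : ℝ} (hx : 0 ≤ x) (hy : 0 ≤ y) {a b : ℕ → ℕ} {C : ℝ}
    (ha : ∀ n : ℕ, |(a n : ℝ) - n * x| ≤ C) (hb : ∀ n : ℕ, |(b n : ℝ) - n * y| ≤ C) :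
    Tendsto (fun n : ℕ => meanLcs k (a n) (b n) / n) atTop (𝓝 (shape k x y)) := by
  have h0 : Tendsto (fun n : ℕ => (2 * C + 2) / (n : ℝ)) atTop (𝓝 0) :=
    tendsto_const_div_atTop_nhds_zero_nat _
  have h1 : Tendsto (fun n : ℕ => meanLcs k (a n) (b n) / n -
      meanLcs k ⌊n * x⌋₊ ⌊n * y⌋₊ / n) atTop (𝓝 0) := by
    refine squeeze_zero_norm (fun n => ?_) h0
    rw [← sub_div, Real.norm_eq_abs, abs_div, Nat.abs_cast]
    refine div_le_div_of_nonneg_right ?_ (Nat.cast_nonneg n)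
    refine (abs_meanLcs_sub_le _ _ _ _).trans ?_
    have aux : ∀ {z : ℝ} {j : ℕ}, 0 ≤ z → |(j : ℝ) - n * z| ≤ C →
        |(j : ℝ) - (⌊n * z⌋₊ : ℕ)| ≤ C + 1 := by
      intro z j hz hj
      have f1 := Nat.floor_le (show (0 : ℝ) ≤ n * z by positivity)
      have f2 := Nat.lt_floor_add_one ((n : ℝ) * z)
      rw [abs_le] at hj ⊢
      constructor <;> linarith
    have := aux hx (ha n)
    have := aux hy (hb n)
    linarith
  simpa using h1.add (tendsto_shape (k := k) hx hy)

theorem shape_add_le {x y x' y' : ℝ} (hx : 0 ≤ x) (hy : 0 ≤ y) (hx' : 0 ≤ x') (hy' : 0 ≤ y') :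
    shape k x y + shape k x' y' ≤ shape k (x + x') (y + y') := by
  refine le_of_tendsto_of_tendsto' ((tendsto_shape hx hy).add (tendsto_shape hx' hy'))
    (tendsto_shape (add_nonneg hx hx') (add_nonneg hy hy')) fun n => ?_
  rw [← add_div]
  refine div_le_div_of_nonneg_right ((meanLcs_add_le _ _ _ _).trans (meanLcs_mono ?_ ?_))
    (Nat.cast_nonneg n)
  · refine Nat.le_floor ?_
    have f1 := Nat.floor_le (show (0 : ℝ) ≤ n * x by positivity)
    have f2 := Nat.floor_le (show (0 : ℝ) ≤ n * x' by positivity)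
    push_cast
    linarith
  · refine Nat.le_floor ?_
    have f1 := Nat.floor_le (show (0 : ℝ) ≤ n * y by positivity)
    have f2 := Nat.floor_le (show (0 : ℝ) ≤ n * y' by positivity)
    push_cast
    linarith

theorem shape_le_left {x y : ℝ} (hx : 0 ≤ x) (hy : 0 ≤ y) : shape k x y ≤ x := by
  refine le_of_tendsto (tendsto_shape hx hy) ((eventually_gt_atTop 0).mono fun n hn => ?_)
  have hn' : (0 : ℝ) < n := Nat.cast_pos.2 hn
  rw [div_le_iff₀ hn', mul_comm]
  exact (meanLcs_le_left _ _).trans (Nat.floor_le (by positivity))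

theorem shape_le_add_right {x y y' : ℝ} (hx : 0 ≤ x) (hy : 0 ≤ y) (h : y ≤ y') :
    shape k x y' ≤ shape k x y + (y' - y) := by
  have h0 : Tendsto (fun n : ℕ => meanLcs k ⌊n * x⌋₊ ⌊n * y⌋₊ / n + ((y' - y) + 1 / (n : ℝ)))
      atTop (𝓝 (shape k x y + ((y' - y) + 0))) :=
    (tendsto_shape hx hy).add (tendsto_const_nhds.add (tendsto_const_div_atTop_nhds_zero_nat 1))
  rw [add_zero] at h0
  refine le_of_tendsto_of_tendsto (tendsto_shape hx (hy.trans h)) h0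
    ((eventually_gt_atTop 0).mono fun n hn => ?_)
  have hn' : (0 : ℝ) < n := Nat.cast_pos.2 hn
  have e : meanLcs k ⌊n * x⌋₊ ⌊n * y⌋₊ / n + ((y' - y) + 1 / (n : ℝ)) =
      (meanLcs k ⌊n * x⌋₊ ⌊n * y⌋₊ + (n * (y' - y) + 1)) / n := by
    field_simp
  refine le_of_le_of_eq (div_le_div_of_nonneg_right ?_ hn'.le) e.symm
  have hm : ⌊(n : ℝ) * y⌋₊ ≤ ⌊(n : ℝ) * y'⌋₊ := Nat.floor_le_floor (by gcongr)
  have h1 := meanLcs_le_add_abs (k := k) ⌊n * x⌋₊ ⌊n * y'⌋₊ ⌊n * x⌋₊ ⌊n * y⌋₊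
  rw [sub_self, abs_zero, abs_of_nonneg (sub_nonneg.2 (Nat.cast_le.2 hm))] at h1
  have f1 := Nat.floor_le (show (0 : ℝ) ≤ n * y' from mul_nonneg hn'.le (hy.trans h))
  have f2 := Nat.lt_floor_add_one ((n : ℝ) * y)
  linarith

theorem shape_mul {c x y : ℝ} (hc : 0 < c) (hx : 0 ≤ x) (hy : 0 ≤ y) :
    shape k (c * x) (c * y) = c * shape k x y := by
  have hfl : Tendsto (fun n : ℕ => ⌊(n : ℝ) * c⌋₊) atTop atTop :=
    tendsto_nat_floor_atTop.comp (tendsto_natCast_atTop_atTop.atTop_mul_const hc)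
  have h1 := (tendsto_shape (k := k) hx hy).comp hfl
  have h2 : Tendsto (fun n : ℕ => (⌊(n : ℝ) * c⌋₊ : ℝ) / n) atTop (𝓝 c) := by
    have := (tendsto_nat_floor_mul_div_atTop hc.le).comp (tendsto_natCast_atTop_atTop (R := ℝ))
    refine this.congr fun n => ?_
    simp [mul_comm]
  have h3 := h2.mul h1
  have aux : ∀ {z : ℝ}, 0 ≤ z → z ≤ x + y → ∀ n : ℕ,
      |((⌊(⌊(n : ℝ) * c⌋₊ : ℝ) * z⌋₊ : ℕ) : ℝ) - n * (c * z)| ≤ x + y + 1 := by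
    intro z hz hzxy n
    have f1 := Nat.floor_le (show (0 : ℝ) ≤ n * c by positivity)
    have f2 := Nat.lt_floor_add_one ((n : ℝ) * c)
    have f3 := Nat.floor_le (show (0 : ℝ) ≤ (⌊(n : ℝ) * c⌋₊ : ℝ) * z by positivity)
    have f4 := Nat.lt_floor_add_one ((⌊(n : ℝ) * c⌋₊ : ℝ) * z)
    have f5 := mul_le_mul_of_nonneg_right f1 hz
    have f6 := mul_le_mul_of_nonneg_right f2.le hz
    rw [abs_le]
    constructor <;> linarith
  refine tendsto_nhds_unique (tendsto_shape_of_abs_sub_le (k := k)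
    (mul_nonneg hc.le hx) (mul_nonneg hc.le hy) (aux hx (by linarith)) (aux hy (by linarith))) ?_
  refine h3.congr' ?_
  filter_upwards [hfl.eventually_gt_atTop 0] with n hn
  have hn' : (0 : ℝ) < (⌊(n : ℝ) * c⌋₊ : ℝ) := Nat.cast_pos.2 hn
  simp only [Function.comp]
  field_simp

/-- The shape function is concave in the second length. -/
theorem concaveOn_shape : ConcaveOn ℝ (Set.Ici 0) (shape k 1) := by
  refine ⟨convex_Ici 0, fun x hx y hy a b ha hb hab => ?_⟩
  simp only [Set.mem_Ici] at hx hy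
  rcases ha.eq_or_lt with rfl | ha'
  · have : b = 1 := by linarith
    simp [this]
  rcases hb.eq_or_lt with rfl | hb'
  · have : a = 1 := by linarith
    simp [this]
  simp only [smul_eq_mul]
  rw [← shape_mul ha' zero_le_one hx, ← shape_mul hb' zero_le_one hy]
  refine (shape_add_le ?_ ?_ ?_ ?_).trans (le_of_eq ?_)
  · linarith
  · positivity
  · linarith
  · positivity
  · rw [mul_one, mul_one, hab]

theorem gammaStar_eq_shape : gammaStar k = shape k 1 1 := by
  have := tendsto_shape (k := k) zero_le_one zero_le_one
  simp only [mul_one, Nat.floor_natCast] at this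
  exact this.limUnder_eq

/-- Exchanging the roles of the two strings and averaging gives the bound by the diagonal. -/
theorem shape_le_gammaStar {x y : ℝ} (hx : 0 ≤ x) (hy : 0 ≤ y) :
    shape k x y ≤ (x + y) / 2 * gammaStar k := by
  rcases (add_nonneg hx hy).eq_or_lt with h | h
  · have : x = 0 := by linarith
    rw [← h, zero_div, zero_mul, ← this]
    exact shape_le_left hx hy
  have h1 := shape_add_le (k := k) hx hy hy hx
  rw [shape_comm (x := y), add_comm y x] at h1
  have h2 := shape_mul (k := k) h zero_le_one zero_le_one
  rw [mul_one] at h2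
  rw [gammaStar_eq_shape]
  linarith

theorem gammaStar_le_one : gammaStar k ≤ 1 := by
  rw [gammaStar_eq_shape]
  exact shape_le_left zero_le_one zero_le_one

theorem abs_roundPos_sub_le {x : ℝ} (hx : 0 ≤ x) : |(roundPos x : ℝ) - x| ≤ 1 := by
  have h := abs_sub_round x
  have h0 : 0 ≤ round x := by
    rw [round_eq]
    exact Int.floor_nonneg.2 (by linarith)
  obtain ⟨r, hr⟩ := Int.eq_ofNat_of_zero_le h0
  rw [roundPos, hr, Int.toNat_natCast]
  rw [hr, Int.cast_natCast, abs_le] at h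
  rw [abs_le]
  rcases Nat.eq_zero_or_pos r with rfl | hr0
  · simp only [Nat.cast_zero] at h
    simp only [zero_le, sup_of_le_left, Nat.cast_one]
    constructor <;> linarith
  · rw [max_eq_right hr0]
    constructor <;> linarith

theorem gammaFn_eq_shape {p : ℝ} (hp : p ∈ Set.Ioo (-1 : ℝ) 1) :
    gammaFn k p = shape k (1 - p) (1 + p) := by
  have h1 : (0 : ℝ) ≤ 1 - p := by linarith [hp.2]
  have h2 : (0 : ℝ) ≤ 1 + p := by linarith [hp.1]
  refine Tendsto.limUnder_eq (tendsto_shape_of_abs_sub_le (k := k) h1 h2 (C := 1)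
    (fun n => ?_) fun n => ?_)
  · have := abs_roundPos_sub_le (show (0 : ℝ) ≤ n * (1 - p) by positivity)
    rwa [show (n : ℝ) * (1 - p) = n - n * p by ring] at this ⊢
  · have := abs_roundPos_sub_le (show (0 : ℝ) ≤ n * (1 + p) by positivity)
    rwa [show (n : ℝ) * (1 + p) = n + n * p by ring] at this ⊢

theorem gammaFn_zero : gammaFn k 0 = gammaStar k := by
  rw [gammaFn_eq_shape (by norm_num), gammaStar_eq_shape, sub_zero, add_zero]

theorem gammaFn_le_gammaStar {p : ℝ} (hp : p ∈ Set.Ioo (-1 : ℝ) 1) :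
    gammaFn k p ≤ gammaStar k := by
  rw [gammaFn_eq_shape hp]
  have := shape_le_gammaStar (k := k) (x := 1 - p) (y := 1 + p) (by linarith [hp.2])
    (by linarith [hp.1])
  linarith

/-! ### The slope of the shape function at the diagonal -/

theorem isMaxOn_gammaFn_iff {p : ℝ} (hp : p ∈ Set.Ioo (-1 : ℝ) 1) :
    IsMaxOn (gammaFn k) (Set.Ioo (-1) 1) p ↔ gammaFn k p = gammaStar k := by
  constructor
  · intro h
    refine le_antisymm (gammaFn_le_gammaStar hp) ?_
    rw [← gammaFn_zero]
    exact h (by norm_num)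
  · intro h q hq
    simp only [Set.mem_ofPred_eq, h]
    exact gammaFn_le_gammaStar hq

theorem pM_mem_closure_and_bounds (hpos : 0 < gammaStar k) :
    pM k ∈ closure {p : ℝ | p ∈ Set.Ioo (-1 : ℝ) 1 ∧ IsMaxOn (gammaFn k) (Set.Ioo (-1) 1) p} ∧
      0 ≤ pM k ∧ pM k < 1 := by
  have h0 : (0 : ℝ) ∈ {p : ℝ | p ∈ Set.Ioo (-1 : ℝ) 1 ∧
      IsMaxOn (gammaFn k) (Set.Ioo (-1) 1) p} :=
    ⟨by norm_num, (isMaxOn_gammaFn_iff (by norm_num)).2 gammaFn_zero⟩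
  -- A string of relative length `1 - p` cannot score `gammaStar k` if `p` is close to one.
  have hub : ∀ p ∈ {p : ℝ | p ∈ Set.Ioo (-1 : ℝ) 1 ∧
      IsMaxOn (gammaFn k) (Set.Ioo (-1) 1) p}, p ≤ 1 - gammaStar k := by
    rintro p ⟨hp, hmax⟩
    have h1 := (isMaxOn_gammaFn_iff hp).1 hmax
    rw [gammaFn_eq_shape hp] at h1
    have := shape_le_left (k := k) (x := 1 - p) (y := 1 + p) (by linarith [hp.2])
      (by linarith [hp.1])
    linarith
  refine ⟨csSup_mem_closure ⟨0, h0⟩ ⟨_, hub⟩, le_csSup ⟨_, hub⟩ h0, ?_⟩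
  have : pM k ≤ 1 - gammaStar k := csSup_le ⟨0, h0⟩ hub
  linarith

theorem gammaFn_pM (hpos : 0 < gammaStar k) (hdiff : DifferentiableAt ℝ (gammaFn k) (pM k)) :
    gammaFn k (pM k) = gammaStar k := by
  have hcl := (pM_mem_closure_and_bounds hpos).1
  rw [mem_closure_iff_frequently] at hcl
  have h1 := hcl.mono fun p hp => (isMaxOn_gammaFn_iff hp.1).1 hp.2
  have h2 : ClusterPt (gammaStar k) (map (gammaFn k) (𝓝 (pM k))) := by
    rw [clusterPt_iff_frequently]
    intro s hs
    rw [frequently_map]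
    exact h1.mono fun p hp => hp ▸ mem_of_mem_nhds hs
  exact (eq_of_nhds_neBot (h2.mono hdiff.continuousAt)).symm

theorem hasDerivAt_gammaFn_pM (hpos : 0 < gammaStar k)
    (hdiff : DifferentiableAt ℝ (gammaFn k) (pM k)) : HasDerivAt (gammaFn k) 0 (pM k) := by
  obtain ⟨-, h0, h1⟩ := pM_mem_closure_and_bounds hpos
  have hmax : IsLocalMax (gammaFn k) (pM k) := by
    filter_upwards [Ioo_mem_nhds (show (-1 : ℝ) < pM k by linarith) h1] with q hq
    rw [gammaFn_pM hpos hdiff]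
    exact gammaFn_le_gammaStar hq
  rw [← hmax.deriv_eq_zero]
  exact hdiff.hasDerivAt

/-- Differentiability at `pM k` makes the mean LCS function flat there, so that slightly beyond
this direction an additional letter of the second string still contributes almost
`gammaStar k / 2`; by concavity this holds before that direction, too. -/
theorem exists_le_shape_sub (hpos : 0 < gammaStar k)
    (hdiff : DifferentiableAt ℝ (gammaFn k) (pM k)) {ε : ℝ} (hε : 0 < ε) :
    ∃ τ : ℝ, 1 < τ ∧ ∀ t₁ t₂ : ℝ, 0 ≤ t₁ → t₁ ≤ t₂ → t₂ ≤ τ →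
      (gammaStar k / 2 - ε) * (t₂ - t₁) ≤ shape k 1 t₂ - shape k 1 t₁ := by
  obtain ⟨-, h0, h1⟩ := pM_mem_closure_and_bounds hpos
  have hd := (hasDerivAt_gammaFn_pM hpos hdiff).isLittleO.def hε
  obtain ⟨r, hr, hball⟩ := Metric.eventually_nhds_iff.1 hd
  set ρ : ℝ := min (r / 2) ((1 - pM k) / 2) with hρ
  have hρ0 : 0 < ρ := lt_min (by linarith) (by linarith)
  have hρr : ρ < r := (min_le_left _ _).trans_lt (by linarith)
  have hρ1 : ρ < 1 - pM k := (min_le_right _ _).trans_lt (by linarith)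
  set p : ℝ := pM k + ρ / 2 with hp
  set q : ℝ := pM k + ρ with hq
  have hp1 : 0 < 1 - p := by linarith
  have hq1 : 0 < 1 - q := by linarith
  have hγq : gammaStar k - ε * ρ ≤ gammaFn k q := by
    have := hball (y := q) (by rw [hq, Real.dist_eq, add_sub_cancel_left, abs_of_pos hρ0]; exact hρr)
    rw [gammaFn_pM hpos hdiff, smul_zero, sub_zero, hq, add_sub_cancel_left, Real.norm_eq_abs,
      Real.norm_eq_abs, abs_of_pos hρ0, abs_le] at this
    linarith [this.1]
  set T : ℝ := (1 + p) / (1 - p) with hT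
  set S : ℝ := (1 + q) / (1 - q) with hS
  have hT1 : 1 < T := by rw [hT, lt_div_iff₀ hp1]; linarith
  have hS0 : 0 ≤ S := div_nonneg (by linarith) hq1.le
  have hST : S - T = ρ / ((1 - p) * (1 - q)) := by
    rw [hS, hT, div_sub_div _ _ hq1.ne' hp1.ne', mul_comm (1 - p) (1 - q)]
    congr 1
    rw [hp, hq]; ring
  have hTS : T < S := by
    have : 0 < ρ / ((1 - p) * (1 - q)) := by positivity
    linarith
  have hslope : gammaStar k / 2 - ε ≤ (shape k 1 S - shape k 1 T) / (S - T) := by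
    have e1 : shape k 1 T ≤ gammaStar k / (1 - p) := by
      have := shape_le_gammaStar (k := k) zero_le_one (y := T) (by linarith)
      refine this.trans (le_of_eq ?_)
      rw [hT]; field_simp; ring
    have e2 : (gammaStar k - ε * ρ) / (1 - q) ≤ shape k 1 S := by
      have := shape_mul (k := k) hq1 zero_le_one hS0
      rw [mul_one, hS, mul_div_cancel₀ _ hq1.ne', ← hS,
        ← gammaFn_eq_shape ⟨by linarith, by linarith⟩] at this
      rw [div_le_iff₀ hq1, mul_comm (shape k 1 S), ← this]
      exact hγq
    rw [le_div_iff₀ (sub_pos.2 hTS)]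
    have e3 : (gammaStar k / 2 - ε * (1 - p)) * (S - T) =
        (gammaStar k - ε * ρ) / (1 - q) - gammaStar k / (1 - p) := by
      rw [hST]
      have : ρ = 2 * (q - p) := by rw [hp, hq]; ring
      rw [this]; field_simp; ring
    have e4 : (gammaStar k / 2 - ε) * (S - T) ≤ (gammaStar k / 2 - ε * (1 - p)) * (S - T) := by
      refine mul_le_mul_of_nonneg_right ?_ (sub_pos.2 hTS).le
      have : 0 ≤ ε * p := by positivity
      linarith
    linarith
  refine ⟨T, hT1, fun t₁ t₂ h₁ h₁₂ h₂ => ?_⟩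
  rcases h₁₂.eq_or_lt with rfl | hlt
  · simp
  rw [← le_div_iff₀ (sub_pos.2 hlt)]
  refine hslope.trans ?_
  have hmem : ∀ {t : ℝ}, 0 ≤ t → t ∈ Set.Ici (0 : ℝ) := fun h => h
  rcases h₂.eq_or_lt with rfl | h₂'
  · exact concaveOn_shape.slope_anti_adjacent (hmem h₁) (hmem hS0) hlt hTS
  · exact (concaveOn_shape.slope_anti_adjacent (hmem (h₁.trans h₁₂)) (hmem hS0) h₂' hTS).trans
      (concaveOn_shape.slope_anti_adjacent (hmem h₁) (hmem (by linarith)) hlt h₂')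

end Shape

/-! ### Finite-size increments of the mean LCS length -/

section Increments

variable {k : ℕ} [NeZero k]

/-- The convergence to the shape function is uniform over bounded ratios of the lengths, since
both sides are monotone and Lipschitz in the second length. -/
theorem eventually_shape_sub_le_meanLcs (τ : ℝ) {ε : ℝ} (hε : 0 < ε) :
    ∀ᶠ s : ℕ in atTop, ∀ t : ℕ, (t : ℝ) ≤ τ * s →
      s * shape k 1 (t / s) - ε * s ≤ meanLcs k s t := by
  obtain ⟨N, hN⟩ := exists_nat_gt (2 / ε)
  have hN0 : (0 : ℝ) < N := lt_trans (by positivity) hN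
  have hNε : 1 / (N : ℝ) ≤ ε / 2 := by
    rw [div_le_iff₀ hN0]
    rw [div_lt_iff₀ hε] at hN
    linarith
  have hgrid : ∀ g ∈ Finset.range (⌊τ * N⌋₊ + 1), ∀ᶠ s : ℕ in atTop,
      shape k 1 (g / N) - ε / 2 ≤ meanLcs k s ⌊s * ((g : ℝ) / N)⌋₊ / s := by
    intro g _
    have := tendsto_shape (k := k) zero_le_one (y := (g : ℝ) / N) (by positivity)
    simp only [mul_one, Nat.floor_natCast] at this
    exact this.eventually_const_le (by linarith)
  filter_upwards [(Finset.eventually_all _).2 hgrid, eventually_gt_atTop 0] with s hs hs0 t ht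
  have hs0' : (0 : ℝ) < s := Nat.cast_pos.2 hs0
  set g : ℕ := ⌊(t : ℝ) / s * N⌋₊ with hg
  have hg1 : (g : ℝ) ≤ t / s * N := Nat.floor_le (by positivity)
  have hg2 : (t : ℝ) / s * N < g + 1 := Nat.lt_floor_add_one _
  have hts : (t : ℝ) / s ≤ τ := by rwa [div_le_iff₀ hs0']
  have hgmem : g ∈ Finset.range (⌊τ * N⌋₊ + 1) :=
    Finset.mem_range.2 (Nat.lt_succ_of_le (Nat.floor_le_floor (by gcongr)))
  have h1 := hs g hgmem
  rw [le_div_iff₀ hs0'] at h1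
  have hgt : (g : ℝ) / N ≤ t / s := by rwa [div_le_iff₀ hN0]
  have h2 : meanLcs k s ⌊s * ((g : ℝ) / N)⌋₊ ≤ meanLcs k s t := by
    refine meanLcs_mono le_rfl (Nat.floor_le_of_le ?_)
    calc s * ((g : ℝ) / N) ≤ s * ((t : ℝ) / s) := by gcongr
      _ = t := by field_simp
  have h3 := shape_le_add_right (k := k) zero_le_one (y := (g : ℝ) / N) (by positivity) hgt
  have h4 : (t : ℝ) / s - g / N ≤ 1 / N := by
    rw [sub_le_iff_le_add, ← add_div, le_div_iff₀ hN0]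
    linarith
  have h5 : shape k 1 (t / s) - ε ≤ shape k 1 (g / N) - ε / 2 := by linarith
  have h6 := mul_le_mul_of_nonneg_right h5 hs0'.le
  linarith

theorem exists_eventually_mul_le_meanLcs_sub (hpos : 0 < gammaStar k)
    (hdiff : DifferentiableAt ℝ (gammaFn k) (pM k)) {c : ℝ} (hc : c < gammaStar k / 2) :
    ∃ τ : ℝ, 1 < τ ∧ ∀ M : ℕ, 0 < M → ∀ᶠ h : ℕ in atTop, ∀ t : ℕ,
      (t : ℝ) + h ≤ τ * (M * h : ℕ) →
      c * h ≤ meanLcs k (M * h) (t + h) - meanLcs k (M * h) t := by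
  set ε : ℝ := (gammaStar k / 2 - c) / 2 with hε
  have hε0 : 0 < ε := by linarith
  obtain ⟨τ, hτ, hslope⟩ := exists_le_shape_sub hpos hdiff hε0
  refine ⟨τ, hτ, fun M hM => ?_⟩
  have hM' : (0 : ℝ) < M := Nat.cast_pos.2 hM
  have hmul : Tendsto (fun h : ℕ => M * h) atTop atTop := tendsto_id.const_mul_atTop' hM
  filter_upwards [hmul.eventually (eventually_shape_sub_le_meanLcs (k := k) τ
    (div_pos hε0 hM')), eventually_gt_atTop 0] with h hh hh0 t ht
  have hh0' : (0 : ℝ) < h := Nat.cast_pos.2 hh0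
  set s : ℕ := M * h with hs
  have hs0 : (0 : ℝ) < s := by rw [hs]; push_cast; positivity
  have h1 := hh (t + h) (by push_cast; exact ht)
  have h2 := meanLcs_le_shape (k := k) s t
  have h3 := shape_mul (k := k) hs0 zero_le_one (y := (t : ℝ) / s) (by positivity)
  rw [mul_one, mul_div_cancel₀ _ hs0.ne'] at h3
  have h4 := hslope (t / s) ((t + h : ℕ) / s) (by positivity)
    (by push_cast; gcongr; linarith) (by rw [div_le_iff₀ hs0]; push_cast; exact ht)
  have h5 := mul_le_mul_of_nonneg_left h4 hs0.le
  have h6 : (s : ℝ) * ((gammaStar k / 2 - ε) * (((t + h : ℕ) : ℝ) / s - t / s)) =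
      (gammaStar k / 2 - ε) * h := by
    push_cast; field_simp; ring
  have h7 : ε / M * s = ε * h := by rw [hs]; push_cast; field_simp
  have h8 : c * h = (gammaStar k / 2 - ε) * h - ε * h := by rw [hε]; ring
  rw [h6] at h5
  rw [h7] at h1
  rw [h3] at h2
  linarith

theorem prob_cut {m n i s j t : ℕ} (hi : i + s ≤ m) (hj : j + t ≤ n)
    (Q : List (Fin k) → List (Fin k) → Prop) :
    prob m n (fun x y => Q (x.take i ++ x.drop (i + s)) (y.take j ++ y.drop (j + t))) =
      prob (m - s) (n - t) Q := by
  classical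
  rw [prob, prob, ← avg_cut hi]
  refine avg_congr fun x _ => ?_
  rw [← avg_cut hj]

theorem prob_window {m n i s j t : ℕ} (hi : i + s ≤ m) (hj : j + t ≤ n)
    (Q : List (Fin k) → List (Fin k) → Prop) :
    prob m n (fun x y => Q ((x.drop i).take s) ((y.drop j).take t)) = prob s t Q := by
  classical
  rw [prob, prob, ← avg_window hi]
  refine avg_congr fun x _ => ?_
  rw [← avg_window hj]

/-- Up to fluctuations, some piece of `s` letters and at most `T` letters can be cut out of the
two strings such that the mean LCS length is at most the sum of the mean LCS lengths of the piece
and of the remainder. It is found in a realization in which all relevant scores are close to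
their means. -/
theorem exists_meanLcs_le_add {m b s T q : ℕ} {r : ℝ} (hr : 0 ≤ r) (hq : q * s ≤ m)
    (hb : b < q * (T + 1)) (hmb : 0 < m + b)
    (hsmall : 3 * ((m + b : ℕ) + 1 : ℝ) ^ 3 * Real.exp (-(r ^ 2 / (2 * (m + b : ℕ)))) < 1) :
    ∃ t : ℕ, t ≤ T ∧ t ≤ b ∧
      meanLcs k m b ≤ meanLcs k (m - s) (b - t) + meanLcs k s t + 3 * r := by
  by_contra! H
  set e : ℝ := Real.exp (-(r ^ 2 / (2 * (m + b : ℕ)))) with he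
  have he0 : 0 < e := Real.exp_pos _
  set I : Finset (ℕ × ℕ × ℕ) := (Finset.range (m + 1) ×ˢ Finset.range (b + 1) ×ˢ
    Finset.range (b + 1)).filter (fun z => z.1 + s ≤ m ∧ z.2.1 + z.2.2 ≤ b) with hI
  let B : ℕ × ℕ × ℕ → List (Fin k) → List (Fin k) → Prop := fun z x y =>
    (meanLcs k (m - s) (b - z.2.2) + r ≤ lcsLen (x.take z.1 ++ x.drop (z.1 + s))
      (y.take z.2.1 ++ y.drop (z.2.1 + z.2.2))) ∨
    (meanLcs k s z.2.2 + r ≤ lcsLen ((x.drop z.1).take s) ((y.drop z.2.1).take z.2.2))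
  have hB : ∀ z ∈ I, prob m b (B z) ≤ 2 * e := by
    rintro ⟨i, v, t⟩ hz
    obtain ⟨-, hi, hv⟩ := Finset.mem_filter.1 hz
    refine (prob_or_le _ _ _ _).trans ?_
    rw [prob_cut hi hv (fun x y => meanLcs k (m - s) (b - t) + r ≤ lcsLen x y),
      prob_window hi hv (fun x y => meanLcs k s t + r ≤ lcsLen x y), two_mul]
    simp only at hi hv
    exact add_le_add (prob_meanLcs_add_le hmb (by dsimp only; omega) hr)
      (prob_meanLcs_add_le hmb (by dsimp only; omega) hr)
  have hcard : (I.card : ℝ) ≤ ((m + b : ℕ) + 1 : ℝ) ^ 3 := by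
    have h1 : I.card ≤ (m + 1) * ((b + 1) * (b + 1)) :=
      (Finset.card_filter_le _ _).trans (by simp [Finset.card_product])
    have h2 : (m + 1) * ((b + 1) * (b + 1)) ≤ (m + b + 1) * ((m + b + 1) * (m + b + 1)) := by
      gcongr <;> omega
    have h3 : (I.card : ℝ) ≤ (((m + b + 1) * ((m + b + 1) * (m + b + 1)) : ℕ) : ℝ) := by
      exact_mod_cast h1.trans h2
    refine h3.trans (le_of_eq ?_)
    push_cast; ring
  have hlt : prob m b (fun x y : List (Fin k) => (lcsLen x y : ℝ) ≤ meanLcs k m b - r ∨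
      ∃ z ∈ I, B z x y) < 1 := by
    refine (prob_or_le _ _ _ _).trans_lt ?_
    have h1 := prob_le_meanLcs_sub (k := k) hmb le_rfl hr
    have h2 := prob_exists_le m b I B hB
    have h3 : (1 : ℝ) ≤ ((m + b : ℕ) + 1 : ℝ) ^ 3 :=
      one_le_pow₀ (by linarith [Nat.cast_nonneg (α := ℝ) (m + b)])
    have h4 := mul_le_mul_of_nonneg_right hcard (show 0 ≤ 2 * e by positivity)
    have h5 := mul_le_mul_of_nonneg_right h3 he0.le
    linarith
  obtain ⟨x, y, hx, hy, hnot⟩ := exists_of_prob_lt_one hlt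
  push Not at hnot
  obtain ⟨hlow, hgood⟩ := hnot
  obtain ⟨u₁, u₂, u₃, v₁, v₂, v₃, rfl, rfl, hs, ht, hle⟩ :=
    exists_short_piece s T q x y (by omega) (by omega)
  simp only [List.length_append] at hx hy
  have hmem : (u₁.length, v₁.length, v₂.length) ∈ I := by
    simp only [hI, Finset.mem_filter, Finset.mem_product, Finset.mem_range]
    omega
  have hg := hgood _ hmem
  simp only [B, not_or, not_le] at hg
  obtain ⟨hg1, hg2⟩ := hg
  have ed : ∀ w₁ w₂ w₃ : List (Fin k),
      (w₁ ++ (w₂ ++ w₃)).take w₁.length ++ (w₁ ++ (w₂ ++ w₃)).drop (w₁.length + w₂.length) =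
        w₁ ++ w₃ ∧ ((w₁ ++ (w₂ ++ w₃)).drop w₁.length).take w₂.length = w₂ := by
    intro w₁ w₂ w₃
    rw [List.take_left, List.drop_left, List.take_left, ← List.append_assoc,
      ← List.length_append, List.drop_left]
    exact ⟨rfl, rfl⟩
  rw [← hs, (ed u₁ u₂ u₃).1, (ed v₁ v₂ v₃).1, hs] at hg1
  rw [← hs, (ed u₁ u₂ u₃).2, (ed v₁ v₂ v₃).2, hs] at hg2
  have hH := H v₂.length ht (by omega)
  have hle' : (lcsLen (u₁ ++ (u₂ ++ u₃)) (v₁ ++ (v₂ ++ v₃)) : ℝ) ≤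
      lcsLen (u₁ ++ u₃) (v₁ ++ v₃) + lcsLen u₂ v₂ := by exact_mod_cast hle
  linarith

theorem tendsto_pow_mul_exp_neg_rpow (j : ℕ) {c a : ℝ} (hc : 0 < c) (ha : 0 < a) :
    Tendsto (fun m : ℕ => (m : ℝ) ^ j * Real.exp (-(c * (m : ℝ) ^ a))) atTop (𝓝 0) := by
  have h1 := (tendsto_rpow_mul_exp_neg_mul_atTop_nhds_zero ((j : ℝ) / a) c hc).comp
    ((tendsto_rpow_atTop ha).comp (tendsto_natCast_atTop_atTop (R := ℝ)))
  refine h1.congr fun m => ?_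
  simp only [Function.comp]
  rw [← Real.rpow_mul (Nat.cast_nonneg m), mul_div_cancel₀ _ ha.ne', Real.rpow_natCast, neg_mul]

theorem eventually_mul_rpow_le {α : ℝ} (hα : α < 1) (C : ℝ) {η : ℝ} (hη : 0 < η) :
    ∀ᶠ m : ℕ in atTop, C * (m : ℝ) ^ α ≤ η * m := by
  have h1 := ((tendsto_rpow_neg_atTop (show 0 < 1 - α by linarith)).comp
    (tendsto_natCast_atTop_atTop (R := ℝ))).const_mul C
  rw [mul_zero] at h1
  filter_upwards [h1.eventually_le_const hη, eventually_gt_atTop 0] with m hm hm0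
  have hm0' : (0 : ℝ) < m := Nat.cast_pos.2 hm0
  have h2 := mul_le_mul_of_nonneg_right hm hm0'.le
  simp only [Function.comp] at h2
  have h3 : (m : ℝ) ^ (-(1 - α)) * m = (m : ℝ) ^ α := by
    rw [← Real.rpow_add_one hm0'.ne']; congr 1; ring
  rwa [mul_assoc, h3] at h2

/-- As long as the second string is not much longer than the first, its additional letters raise the
mean LCS length by at least `c` per letter, up to an arbitrarily small multiple of `m ^ α`. The
letters are added in portions of order `m ^ α`; for each portion only a piece of the strings of
that order is compared with the shape function. -/
theorem exists_mul_sub_le_meanLcs_sub (hpos : 0 < gammaStar k)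
    (hdiff : DifferentiableAt ℝ (gammaFn k) (pM k)) {c α : ℝ} (hc : c < gammaStar k / 2)
    (hα : 1 / 2 < α) (hα1 : α < 1) :
    ∃ κ : ℝ, 0 < κ ∧ ∀ δ : ℝ, 0 < δ → ∀ᶠ m : ℕ in atTop, ∀ b b' : ℕ, b ≤ b' →
      (b' : ℝ) ≤ (1 + κ) * m →
      c * ((b' : ℝ) - b) - δ * (m : ℝ) ^ α ≤ meanLcs k m b' - meanLcs k m b := by
  set c' : ℝ := (c + gammaStar k / 2) / 2 with hc'
  obtain ⟨τ, hτ, hinc⟩ := exists_eventually_mul_le_meanLcs_sub hpos hdiff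
    (show c' < gammaStar k / 2 by linarith)
  set κ : ℝ := min 1 ((τ - 1) / 3) with hκ
  have hκ0 : 0 < κ := lt_min one_pos (by linarith)
  have hκ1 : κ ≤ 1 := min_le_left _ _
  have hκτ : 1 + 3 * κ ≤ τ := by
    have : κ ≤ (τ - 1) / 3 := min_le_right _ _
    linarith
  obtain ⟨M, hM⟩ := exists_nat_gt (1 / κ)
  have hM0' : (0 : ℝ) < M := lt_trans (by positivity) hM
  have hM0 : 0 < M := Nat.cast_pos.1 hM0'
  have hMκ : 1 ≤ κ * M := by rw [div_lt_iff₀ hκ0] at hM; linarith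
  refine ⟨κ, hκ0, fun δ hδ => ?_⟩
  set δ' : ℝ := δ / (|c| + 1) with hδ'
  have hδ0 : 0 < δ' := by positivity
  have hα0 : 0 < α := by linarith
  set η : ℝ := (c' - c) / 3 with hη
  have hη0 : 0 < η := by linarith
  have hpow : Tendsto (fun m : ℕ => δ' * (m : ℝ) ^ α) atTop atTop :=
    ((tendsto_rpow_atTop hα0).comp (tendsto_natCast_atTop_atTop (R := ℝ))).const_mul_atTop hδ0
  have hfl : Tendsto (fun m : ℕ => ⌊δ' * (m : ℝ) ^ α⌋₊) atTop atTop :=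
    tendsto_nat_floor_atTop.comp hpow
  set C : ℝ := η ^ 2 * δ' ^ 2 / 24 with hC
  have hC0 : 0 < C := by positivity
  have hexp := ((tendsto_pow_mul_exp_neg_rpow 3 hC0 (show 0 < 2 * α - 1 by linarith)).const_mul
    192)
  rw [mul_zero] at hexp
  filter_upwards [hfl.eventually (hinc M hM0), hpow.eventually_ge_atTop 2,
    eventually_mul_rpow_le hα1 (M * δ') (show 0 < κ / 3 by linarith),
    hexp.eventually_lt_const one_pos, eventually_gt_atTop 0] with m hm1 hm2 hm3 hm4 hm0
  have hm0' : (0 : ℝ) < m := Nat.cast_pos.2 hm0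
  have hm1' : (1 : ℝ) ≤ m := by exact_mod_cast hm0
  set h : ℕ := ⌊δ' * (m : ℝ) ^ α⌋₊ with hh
  have hh1 : (h : ℝ) ≤ δ' * (m : ℝ) ^ α := Nat.floor_le (by positivity)
  have hh2 : δ' * (m : ℝ) ^ α / 2 ≤ h := by
    have := Nat.lt_floor_add_one (δ' * (m : ℝ) ^ α)
    rw [← hh] at this
    linarith
  have hh0' : (0 : ℝ) < h := by linarith
  have hh0 : 0 < h := Nat.cast_pos.1 hh0'
  set s : ℕ := M * h with hs
  have hs' : (s : ℝ) = M * h := by rw [hs]; push_cast; ring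
  have hs0 : 0 < s := Nat.mul_pos hM0 hh0
  have hs0' : (0 : ℝ) < s := Nat.cast_pos.2 hs0
  have hsm : (s : ℝ) ≤ κ / 3 * m := by
    refine le_trans ?_ hm3
    rw [hs', mul_assoc]
    exact mul_le_mul_of_nonneg_left hh1 hM0'.le
  have hhs : (h : ℝ) ≤ κ * s := by
    rw [hs']
    have := mul_le_mul_of_nonneg_right hMκ hh0'.le
    linarith
  have hsm' : s ≤ m := by
    have : (s : ℝ) ≤ m := hsm.trans (by
      have := mul_le_mul_of_nonneg_right (show κ / 3 ≤ 1 by linarith) hm0'.le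
      linarith)
    exact_mod_cast this
  set q : ℕ := m / s with hq
  have hq0 : 0 < q := Nat.div_pos hsm' hs0
  have hqs : q * s ≤ m := Nat.div_mul_le_self m s
  have hqs' : (1 - κ / 3) * m ≤ q * s := by
    have h1 : m < q * s + s := by
      have h1 := Nat.div_add_mod m s
      have h2 := Nat.mod_lt m hs0
      rw [← hq, mul_comm] at h1
      omega
    have h2 : (m : ℝ) < q * s + s := by exact_mod_cast h1
    linarith
  have hstep : ∀ b : ℕ, (b : ℝ) ≤ (1 + κ) * m →
      c * h ≤ meanLcs k m (b + h) - meanLcs k m b := by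
    intro b hb
    set T : ℕ := b / q with hT
    have hbT : b < q * (T + 1) := Nat.lt_mul_div_succ b hq0
    have hTq : (T : ℝ) * q ≤ b := by exact_mod_cast Nat.div_mul_le_self b q
    have hTs : (T : ℝ) ≤ (1 + 2 * κ) * s := by
      have h1 : (T : ℝ) * ((1 - κ / 3) * m) ≤ (1 + κ) * m * s := by
        calc (T : ℝ) * ((1 - κ / 3) * m) ≤ T * (q * s) := by gcongr
          _ = T * q * s := by ring
          _ ≤ (1 + κ) * m * s := mul_le_mul_of_nonneg_right (hTq.trans hb) hs0'.le
      have h2 : (T : ℝ) * (1 - κ / 3) ≤ (1 + κ) * s := by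
        refine le_of_mul_le_mul_right ?_ hm0'
        linarith
      have h3 : (1 + κ) * s ≤ ((1 + 2 * κ) * s) * (1 - κ / 3) := by
        have : 0 ≤ κ * (1 - κ) * s := by
          have : 0 ≤ 1 - κ := by linarith
          positivity
        nlinarith
      exact le_of_mul_le_mul_right (h2.trans h3) (by linarith)
    have hmb3 : ((m + b : ℕ) : ℝ) ≤ 3 * m := by
      push_cast
      have := mul_le_mul_of_nonneg_right hκ1 hm0'.le
      linarith
    have hmbpos : (0 : ℝ) < (m + b : ℕ) := Nat.cast_pos.2 (by omega)
    have hsmall : 3 * ((m + b : ℕ) + 1 : ℝ) ^ 3 *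
        Real.exp (-((η * h) ^ 2 / (2 * (m + b : ℕ)))) < 1 := by
      have h1 : C * (m : ℝ) ^ (2 * α - 1) ≤ (η * h) ^ 2 / (2 * (m + b : ℕ)) := by
        have e1 : (m : ℝ) ^ (2 * α - 1) = ((m : ℝ) ^ α) ^ 2 / m := by
          rw [Real.rpow_sub_one hm0'.ne', mul_comm 2 α, Real.rpow_mul hm0'.le, Real.rpow_two]
        calc C * (m : ℝ) ^ (2 * α - 1) = (η * (δ' * (m : ℝ) ^ α / 2)) ^ 2 / (2 * (3 * m)) := by
              rw [e1, hC]; field_simp; ring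
          _ ≤ (η * h) ^ 2 / (2 * (m + b : ℕ)) := by gcongr
      calc 3 * ((m + b : ℕ) + 1 : ℝ) ^ 3 * Real.exp (-((η * h) ^ 2 / (2 * (m + b : ℕ))))
          ≤ 3 * (4 * (m : ℝ)) ^ 3 * Real.exp (-(C * (m : ℝ) ^ (2 * α - 1))) := by
            gcongr
            linarith
        _ = 192 * ((m : ℝ) ^ 3 * Real.exp (-(C * (m : ℝ) ^ (2 * α - 1)))) := by ring
        _ < 1 := hm4
    obtain ⟨t, htT, htb, hle⟩ := exists_meanLcs_le_add (k := k) (show 0 ≤ η * h by positivity)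
      hqs hbT (by omega) hsmall
    have h1 := hm1 t (by
      have : (t : ℝ) ≤ T := by exact_mod_cast htT
      have := mul_le_mul_of_nonneg_right hκτ hs0'.le
      linarith)
    have h2 := meanLcs_add_le (k := k) (m - s) s (b - t) (t + h)
    rw [Nat.sub_add_cancel hsm', show b - t + (t + h) = b + h by omega] at h2
    have h3 : c * h = c' * h - 3 * (η * h) := by rw [hη]; ring
    linarith
  have htel : ∀ (b j : ℕ), ((b + j * h : ℕ) : ℝ) ≤ (1 + κ) * m →
      c * (j * h : ℕ) ≤ meanLcs k m (b + j * h) - meanLcs k m b := by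
    intro b j
    induction j with
    | zero => intro _; simp
    | succ j ih =>
      intro hj
      have e1 : b + (j + 1) * h = b + j * h + h := by ring
      rw [e1] at hj ⊢
      have hj' : ((b + j * h : ℕ) : ℝ) ≤ (1 + κ) * m := by
        refine le_trans ?_ hj
        exact_mod_cast Nat.le_add_right _ _
      have h1 := ih hj'
      have h2 := hstep _ hj'
      push_cast at h1 ⊢
      linarith
  intro b b' hbb hb'
  set j : ℕ := (b' - b) / h with hj
  have hj1 : j * h ≤ b' - b := Nat.div_mul_le_self _ _
  have hj2 : b' - b < j * h + h := by
    have h1 := Nat.div_add_mod (b' - b) h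
    have h2 := Nat.mod_lt (b' - b) hh0
    rw [← hj, mul_comm] at h1
    omega
  have hle : b + j * h ≤ b' := by omega
  have h1 := htel b j (le_trans (by exact_mod_cast hle) hb')
  have h2 := meanLcs_mono (k := k) (le_refl m) hle
  -- The incomplete last step costs at most `|c| * h`.
  have h3 : c * ((b' : ℝ) - b - (j * h : ℕ)) ≤ |c| * h := by
    have e1 : ((j * h : ℕ) : ℝ) ≤ (b' : ℝ) - b := by
      rw [le_sub_iff_add_le']; exact_mod_cast hle
    have e2 : (b' : ℝ) - b ≤ (j * h : ℕ) + h := by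
      rw [sub_le_iff_le_add']
      exact_mod_cast (by omega : b' ≤ b + (j * h + h))
    calc c * ((b' : ℝ) - b - (j * h : ℕ)) ≤ |c| * ((b' : ℝ) - b - (j * h : ℕ)) :=
          mul_le_mul_of_nonneg_right (le_abs_self c) (by linarith)
      _ ≤ |c| * h := mul_le_mul_of_nonneg_left (by linarith) (abs_nonneg c)
  have h4 : |c| * h ≤ δ * (m : ℝ) ^ α := by
    calc |c| * h ≤ (|c| + 1) * (δ' * (m : ℝ) ^ α) :=
          mul_le_mul (by linarith) hh1 hh0'.le (by positivity)
      _ = δ * (m : ℝ) ^ α := by rw [hδ']; field_simp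
  linarith

end Increments

/-! ### Strings with a constant block -/

section Block

variable {k : ℕ}

/-- The string obtained from `x` by writing the letter `c` at all positions of the middle segment
of length `ℓ`: the counterpart of `withBlock` for lists. -/
def blockList (d ℓ : ℕ) (c : Fin k) (x : List (Fin k)) : List (Fin k) :=
  x.take (d - ℓ / 2) ++ (List.replicate ℓ c ++ x.drop (d + ℓ / 2))

theorem withBlock_eq_blockList {d ℓ : ℕ} (hℓ : Even ℓ) (hd : ℓ / 2 ≤ d) (c : Fin k)
    (x : Fin (2 * d) → Fin k) : withBlock d ℓ c x = blockList d ℓ c (List.ofFn x) := by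
  obtain ⟨e, rfl⟩ := hℓ
  have he : (e + e) / 2 = e := by omega
  rw [he] at hd
  apply List.ext_getElem
  · simp only [withBlock, blockList, List.length_ofFn, List.length_append, List.length_take,
      List.length_replicate, List.length_drop, he]
    omega
  · intro i h1 h2
    simp only [withBlock, List.length_ofFn] at h1
    simp only [withBlock, blockList, InBlock, he, List.getElem_ofFn, List.getElem_append,
      List.length_take, List.length_ofFn, List.length_replicate, List.getElem_take,
      List.getElem_replicate, List.getElem_drop]
    split_ifs with c1 c2 c3 c2 c3
    · omega
    · rfl
    · omega
    · rfl
    · omega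
    · congr 1
      ext
      simp only
      omega

theorem cutBlock_blockList {d ℓ : ℕ} (hℓ : Even ℓ) (hd : ℓ / 2 ≤ d) (c : Fin k)
    {x : List (Fin k)} (hx : x.length = 2 * d) :
    cutBlock d ℓ (blockList d ℓ c x) = cutBlock d ℓ x := by
  rw [blockList, cutBlock, cutBlock]
  have h1 : (x.take (d - ℓ / 2)).length = d - ℓ / 2 := by
    rw [List.length_take]; omega
  congr 1
  · exact List.take_left' h1
  · obtain ⟨e, rfl⟩ := hℓ
    rw [← List.append_assoc]
    refine List.drop_left' ?_
    rw [List.length_append, h1, List.length_replicate]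
    omega

theorem blockMatches_eq {d ℓ : ℕ} (hℓ : Even ℓ) (hd : ℓ / 2 ≤ d) (π : Finset (ℕ × ℕ)) :
    blockMatches d ℓ π =
      (π.filter (fun p => d - ℓ / 2 ≤ p.1 ∧ p.1 < d - ℓ / 2 + ℓ)).card := by
  classical
  obtain ⟨e, rfl⟩ := hℓ
  rw [blockMatches]
  congr 1
  ext p
  rw [Finset.mem_filter, Finset.mem_filter, InBlock]
  exact and_congr_right fun _ => by omega

/-- The score of an alignment of the block string with `y` splits at the block. -/
theorem exists_split_blockMatches {d ℓ : ℕ} (hℓ : Even ℓ) (hd : ℓ / 2 ≤ d) {c : Fin k}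
    {x y : List (Fin k)} (hx : x.length = 2 * d) {π : Finset (ℕ × ℕ)}
    (h : IsAlignment (blockList d ℓ c x) y π) :
    ∃ y₁ y₂ y₃ : List (Fin k), y = y₁ ++ (y₂ ++ y₃) ∧
      π.card ≤ lcsLen (x.take (d - ℓ / 2)) y₁ + blockMatches d ℓ π +
        lcsLen (x.drop (d + ℓ / 2)) y₃ ∧
      blockMatches d ℓ π ≤ y₂.count c := by
  have h1 : (x.take (d - ℓ / 2)).length = d - ℓ / 2 := by
    rw [List.length_take]; omega
  have := h.exists_split_block
  rwa [h1, ← blockMatches_eq hℓ hd] at this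

theorem exists_lcsLen_blockList_le (d ℓ : ℕ) (c : Fin k) (x y : List (Fin k)) :
    ∃ y₁ y₂ y₃ : List (Fin k), y = y₁ ++ (y₂ ++ y₃) ∧
      lcsLen (blockList d ℓ c x) y ≤ lcsLen (x.take (d - ℓ / 2)) y₁ + y₂.count c +
        lcsLen (x.drop (d + ℓ / 2)) y₃ := by
  obtain ⟨y₁, y', rfl, h⟩ := exists_lcsLen_append_le (x.take (d - ℓ / 2))
    (List.replicate ℓ c ++ x.drop (d + ℓ / 2)) y
  obtain ⟨y₂, y₃, rfl, h'⟩ := exists_lcsLen_append_le (List.replicate ℓ c)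
    (x.drop (d + ℓ / 2)) y'
  have := lcsLen_replicate_le ℓ c y₂
  exact ⟨y₁, y₂, y₃, rfl, by rw [blockList]; omega⟩

theorem lcsLen_cutBlock_le (d ℓ : ℕ) (c : Fin k) (x y : List (Fin k)) :
    lcsLen (cutBlock d ℓ x) y ≤ lcsLen (blockList d ℓ c x) y :=
  lcsLen_mono ((List.Sublist.refl _).append (List.sublist_append_right _ _))
    (List.Sublist.refl _)

end Block

/-! ### Typical pairs of strings -/

section Typical

variable {k : ℕ}

/-- All scores that matter for the comparison of the block string with the string without the
block deviate from their means by less than `r`, and the letter `c` is not much more frequent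
than expected in any segment of `y`. -/
structure IsTypical (d ℓ : ℕ) (c : Fin k) (r : ℝ) (x y : List (Fin k)) : Prop where
  cut : meanLcs k (2 * d - ℓ) (2 * d) - r < lcsLen (cutBlock d ℓ x) y
  whole : meanLcs k (2 * d) (2 * d) - r < lcsLen x y
  left : ∀ i ≤ 2 * d, (lcsLen (x.take (d - ℓ / 2)) (y.take i) : ℝ) <
    meanLcs k (d - ℓ / 2) i + r
  right : ∀ i ≤ 2 * d, (lcsLen (x.drop (d + ℓ / 2)) (y.drop i) : ℝ) <
    meanLcs k (d - ℓ / 2) (2 * d - i) + r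
  count : ∀ i j, i + j ≤ 2 * d → (((y.drop i).take j).count c : ℝ) < (j : ℝ) / k + r

theorem one_sub_le_prob_isTypical [NeZero k] {d ℓ : ℕ} (hd0 : 0 < d) (hℓ : Even ℓ)
    (hd : ℓ / 2 ≤ d) (c : Fin k) {r : ℝ} (hr : 0 ≤ r) :
    1 - 17 * (d : ℝ) ^ 2 * Real.exp (-(r ^ 2 / (8 * d))) ≤
      prob (2 * d) (2 * d) (IsTypical d ℓ c r) := by
  classical
  obtain ⟨e, rfl⟩ := hℓ
  have he : (e + e) / 2 = e := by omega
  set E : ℝ := Real.exp (-(r ^ 2 / (8 * d))) with hE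
  have hE0 : 0 < E := Real.exp_pos _
  have hN : 0 < 4 * d := by omega
  have hEN : Real.exp (-(r ^ 2 / (2 * (4 * d : ℕ)))) = E := by
    rw [hE]; push_cast; congr 3; ring
  rw [he] at hd
  let B₁ : List (Fin k) → List (Fin k) → Prop := fun x y =>
    (lcsLen (cutBlock d (e + e) x) y : ℝ) ≤ meanLcs k (2 * d - (e + e)) (2 * d) - r
  let B₂ : List (Fin k) → List (Fin k) → Prop := fun x y =>
    (lcsLen x y : ℝ) ≤ meanLcs k (2 * d) (2 * d) - r
  let B₃ : ℕ → List (Fin k) → List (Fin k) → Prop := fun i x y =>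
    meanLcs k (d - e) i + r ≤ lcsLen (x.take (d - e)) (y.take i)
  let B₄ : ℕ → List (Fin k) → List (Fin k) → Prop := fun i x y =>
    meanLcs k (d - e) (2 * d - i) + r ≤ lcsLen (x.drop (d + e)) (y.drop i)
  let B₅ : ℕ × ℕ → List (Fin k) → List (Fin k) → Prop := fun z _ y =>
    (z.2 : ℝ) / k + r ≤ ((y.drop z.1).take z.2).count c
  set J : Finset (ℕ × ℕ) := (Finset.range (2 * d + 1) ×ˢ Finset.range (2 * d + 1)).filter
    (fun z => z.1 + z.2 ≤ 2 * d) with hJ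
  have h1 : prob (2 * d) (2 * d) B₁ ≤ E := by
    have hc := prob_cut (k := k) (m := 2 * d) (n := 2 * d) (i := d - e) (s := e + e) (j := 0)
      (t := 0) (by omega) (by omega)
      (fun x y => (lcsLen x y : ℝ) ≤ meanLcs k (2 * d - (e + e)) (2 * d) - r)
    simp only [List.take_zero, List.drop_zero, List.nil_append, add_zero, Nat.sub_zero,
      show d - e + (e + e) = d + e by omega] at hc
    have hb := prob_le_meanLcs_sub (k := k) hN
      (show 2 * d - (e + e) + 2 * d ≤ 4 * d by omega) hr
    rw [hEN, ← hc] at hb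
    simpa only [B₁, cutBlock, he] using hb
  have h2 : prob (2 * d) (2 * d) B₂ ≤ E := by
    rw [← hEN]
    exact prob_le_meanLcs_sub (k := k) hN (by omega) hr
  have h3 : ∀ i ∈ Finset.range (2 * d + 1), prob (2 * d) (2 * d) (B₃ i) ≤ E := by
    intro i hi
    rw [Finset.mem_range] at hi
    have hw := prob_window (k := k) (m := 2 * d) (n := 2 * d) (i := 0) (s := d - e) (j := 0)
      (t := i) (by omega) (by omega) (fun x y => meanLcs k (d - e) i + r ≤ lcsLen x y)
    simp only [List.drop_zero] at hw
    rw [← hEN]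
    exact hw.trans_le (prob_meanLcs_add_le hN (by omega) hr)
  have h4 : ∀ i ∈ Finset.range (2 * d + 1), prob (2 * d) (2 * d) (B₄ i) ≤ E := by
    intro i hi
    rw [Finset.mem_range] at hi
    have hw := prob_window (k := k) (m := 2 * d) (n := 2 * d) (i := d + e) (s := d - e) (j := i)
      (t := 2 * d - i) (by omega) (by omega)
      (fun x y => meanLcs k (d - e) (2 * d - i) + r ≤ lcsLen x y)
    rw [← hEN]
    refine le_trans (prob_mono fun x y hx hy hB => ?_)
      (hw.trans_le (prob_meanLcs_add_le hN (by omega) hr))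
    rw [List.take_of_length_le (by rw [List.length_drop]; omega),
      List.take_of_length_le (by rw [List.length_drop]; omega)]
    exact hB
  have h5 : ∀ z ∈ J, prob (2 * d) (2 * d) (B₅ z) ≤ E := by
    rintro ⟨i, j⟩ hz
    have hij : i + j ≤ 2 * d := (Finset.mem_filter.1 hz).2
    have hw := avg_window (k := k) hij
      (fun l => if (j : ℝ) / k + r ≤ l.count c then 1 else 0)
    rw [← hEN]
    refine le_trans (le_of_eq ?_) (avg_count_deviation_le (k := k) hN (show j ≤ 4 * d by omega)
      c hr)
    refine Eq.trans (avg_congr fun x _ => Eq.trans (avg_congr fun l _ => ?_) hw)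
      (avg_const (k := k) (2 * d) _)
    simp only [B₅]
  have hJcard : (J.card : ℝ) ≤ (2 * d + 1) ^ 2 := by
    have : J.card ≤ (2 * d + 1) * (2 * d + 1) :=
      (Finset.card_filter_le _ _).trans (by simp [Finset.card_product])
    have h' : (J.card : ℝ) ≤ (((2 * d + 1) * (2 * d + 1) : ℕ) : ℝ) := by exact_mod_cast this
    refine h'.trans (le_of_eq ?_)
    push_cast; ring
  have hd1 : (1 : ℝ) ≤ d := by exact_mod_cast hd0
  rw [prob_compl]
  have hbad : prob (2 * d) (2 * d) (fun x y => ¬ IsTypical d (e + e) c r x y) ≤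
      prob (2 * d) (2 * d) (fun x y => B₁ x y ∨ B₂ x y ∨
        (∃ i ∈ Finset.range (2 * d + 1), B₃ i x y) ∨
        (∃ i ∈ Finset.range (2 * d + 1), B₄ i x y) ∨ ∃ z ∈ J, B₅ z x y) := by
    refine prob_mono fun x y _ _ hT => ?_
    by_contra! hcon
    obtain ⟨c1, c2, c3, c4, c5⟩ := hcon
    refine hT ⟨not_le.1 c1, not_le.1 c2, fun i hi => ?_, fun i hi => ?_, fun i j hij => ?_⟩
    · have := c3 i (Finset.mem_range.2 (by omega))
      rw [he]
      exact not_le.1 this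
    · have := c4 i (Finset.mem_range.2 (by omega))
      rw [he]
      exact not_le.1 this
    · have := c5 (i, j) (by
        simp only [hJ, Finset.mem_filter, Finset.mem_product, Finset.mem_range]; omega)
      exact not_le.1 this
  have u1 := prob_or_le (2 * d) (2 * d) B₁ (fun x y => B₂ x y ∨
        (∃ i ∈ Finset.range (2 * d + 1), B₃ i x y) ∨
        (∃ i ∈ Finset.range (2 * d + 1), B₄ i x y) ∨ ∃ z ∈ J, B₅ z x y)
  have u2 := prob_or_le (2 * d) (2 * d) B₂ (fun x y =>
        (∃ i ∈ Finset.range (2 * d + 1), B₃ i x y) ∨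
        (∃ i ∈ Finset.range (2 * d + 1), B₄ i x y) ∨ ∃ z ∈ J, B₅ z x y)
  have u3 := prob_or_le (2 * d) (2 * d) (fun x y => ∃ i ∈ Finset.range (2 * d + 1), B₃ i x y)
    (fun x y => (∃ i ∈ Finset.range (2 * d + 1), B₄ i x y) ∨ ∃ z ∈ J, B₅ z x y)
  have u4 := prob_or_le (2 * d) (2 * d) (fun x y => ∃ i ∈ Finset.range (2 * d + 1), B₄ i x y)
    (fun x y => ∃ z ∈ J, B₅ z x y)
  have v3 := prob_exists_le (2 * d) (2 * d) _ B₃ h3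
  have v4 := prob_exists_le (2 * d) (2 * d) _ B₄ h4
  have v5 := prob_exists_le (2 * d) (2 * d) _ B₅ h5
  rw [Finset.card_range] at v3 v4
  push_cast at v3 v4
  have w5 := mul_le_mul_of_nonneg_right hJcard hE0.le
  have hpoly : (2 : ℝ) + 2 * (2 * d + 1) + (2 * d + 1) ^ 2 ≤ 17 * (d : ℝ) ^ 2 := by nlinarith
  have w6 := mul_le_mul_of_nonneg_right hpoly hE0.le
  linarith

variable [NeZero k] {d ℓ : ℕ} {c : Fin k} {r : ℝ} {x y : List (Fin k)}

/-- On a typical pair, the two parts of the alignment outside the block score at most as much as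
strings that are shorter by the letters facing the block. -/
theorem IsTypical.split_lt (h : IsTypical d ℓ c r x y) (hℓ : Even ℓ) (hd : ℓ / 2 ≤ d)
    (hy : y.length = 2 * d) {y₁ y₂ y₃ : List (Fin k)} (hyy : y = y₁ ++ (y₂ ++ y₃)) :
    (lcsLen (x.take (d - ℓ / 2)) y₁ : ℝ) + lcsLen (x.drop (d + ℓ / 2)) y₃ <
        meanLcs k (2 * d - ℓ) (2 * d - y₂.length) + 2 * r ∧
      (y₂.count c : ℝ) < (y₂.length : ℝ) / k + r := by
  have hlen : y₁.length + (y₂.length + y₃.length) = 2 * d := by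
    rw [← hy, hyy, List.length_append, List.length_append]
  have h1 := h.left y₁.length (by omega)
  have h3 := h.right (y₁.length + y₂.length) (by omega)
  have h2 := h.count y₁.length y₂.length (by omega)
  have e3 : y.drop (y₁.length + y₂.length) = y₃ := by
    rw [hyy, ← List.append_assoc, ← List.length_append, List.drop_left]
  rw [e3] at h3
  rw [hyy, List.take_left] at h1
  rw [hyy, List.drop_left, List.take_left] at h2
  have hs := meanLcs_add_le (k := k) (d - ℓ / 2) (d - ℓ / 2) y₁.length
    (2 * d - (y₁.length + y₂.length))
  obtain ⟨e, rfl⟩ := hℓ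
  rw [show d - (e + e) / 2 + (d - (e + e) / 2) = 2 * d - (e + e) by omega,
    show y₁.length + (2 * d - (y₁.length + y₂.length)) = 2 * d - y₂.length by omega] at hs
  exact ⟨by linarith, h2⟩

theorem IsTypical.lcsLen_blockList_lt (h : IsTypical d ℓ c r x y) (hℓ : Even ℓ) (hd : ℓ / 2 ≤ d)
    (hy : y.length = 2 * d) {η : ℝ} (hη : 0 ≤ η)
    (hinc : ∀ n ≤ 2 * d, (1 / (k : ℝ) + η) * n - r ≤
      meanLcs k (2 * d - ℓ) (2 * d) - meanLcs k (2 * d - ℓ) (2 * d - n)) :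
    (lcsLen (blockList d ℓ c x) y : ℝ) < meanLcs k (2 * d - ℓ) (2 * d) + 4 * r := by
  obtain ⟨y₁, y₂, y₃, hyy, hle⟩ := exists_lcsLen_blockList_le d ℓ c x y
  obtain ⟨h1, h2⟩ := h.split_lt hℓ hd hy hyy
  have hlen : y₂.length ≤ 2 * d := by
    rw [← hy, hyy, List.length_append, List.length_append]; omega
  have h3 := hinc _ hlen
  have hle' : (lcsLen (blockList d ℓ c x) y : ℝ) ≤ lcsLen (x.take (d - ℓ / 2)) y₁ +
      y₂.count c + lcsLen (x.drop (d + ℓ / 2)) y₃ := by exact_mod_cast hle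
  have h4 : 0 ≤ η * y₂.length := by positivity
  have h5 : (1 / (k : ℝ) + η) * y₂.length = y₂.length / k + η * y₂.length := by ring
  linarith

/-- If many block letters are aligned, the block faces a long segment of `y`; freeing this segment
for the other letters would gain more than the block contributes. -/
theorem IsTypical.blockMatches_le (h : IsTypical d ℓ c r x y) (hℓ : Even ℓ) (hd : ℓ / 2 ≤ d)
    (hx : x.length = 2 * d) (hy : y.length = 2 * d) {η : ℝ} (hη : 0 < η)
    (hinc : ∀ n ≤ 2 * d, (1 / (k : ℝ) + η) * n - r ≤
      meanLcs k (2 * d - ℓ) (2 * d) - meanLcs k (2 * d - ℓ) (2 * d - n))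
    {π : Finset (ℕ × ℕ)} (hπ : IsOptimalAlignment (blockList d ℓ c x) y π) :
    (blockMatches d ℓ π : ℝ) ≤ (5 / (η * k) + 1) * r := by
  have hk : (0 : ℝ) < k := Nat.cast_pos.2 (Nat.pos_of_ne_zero (NeZero.ne k))
  obtain ⟨y₁, y₂, y₃, hyy, hle, hcount⟩ := exists_split_blockMatches hℓ hd hx hπ.1
  obtain ⟨h1, h2⟩ := h.split_lt hℓ hd hy hyy
  have hlen : y₂.length ≤ 2 * d := by
    rw [← hy, hyy, List.length_append, List.length_append]; omega
  have h3 := hinc _ hlen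
  rw [hπ.2] at hle
  have hlow : (lcsLen (cutBlock d ℓ x) y : ℝ) ≤ lcsLen (x.take (d - ℓ / 2)) y₁ +
      blockMatches d ℓ π + lcsLen (x.drop (d + ℓ / 2)) y₃ := by
    exact_mod_cast (lcsLen_cutBlock_le d ℓ c x y).trans hle
  have hcount' : (blockMatches d ℓ π : ℝ) ≤ y₂.count c := by exact_mod_cast hcount
  have h4 := h.cut
  have h5 : (1 / (k : ℝ) + η) * y₂.length = y₂.length / k + η * y₂.length := by ring
  have h6 : η * y₂.length ≤ 5 * r := by linarith
  have h7 : (y₂.length : ℝ) / k ≤ 5 / (η * k) * r := by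
    rw [div_mul_eq_mul_div, div_le_div_iff₀ hk (by positivity)]
    have := mul_le_mul_of_nonneg_right h6 hk.le
    linarith
  linarith

end Typical

/-! ### Transfer to random strings -/

section Transfer

variable {k : ℕ}

theorem IsIIDUniformPair.measureReal_eq {Ω : Type*} [MeasurableSpace Ω] {μ : Measure Ω}
    [IsProbabilityMeasure μ] {n : ℕ} {X Y : Fin n → Ω → Fin k} (h : IsIIDUniformPair μ X Y)
    (x y : Fin n → Fin k) :
    μ.real {ω | (fun i => X i ω) = x ∧ (fun i => Y i ω) = y} = 1 / (k : ℝ) ^ (n + n) := by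
  have hset : {ω | (fun i => X i ω) = x ∧ (fun i => Y i ω) = y} =
      ⋂ i ∈ (Finset.univ : Finset (Fin n ⊕ Fin n)),
        (Sum.elim X Y i) ⁻¹' {Sum.elim x y i} := by
    ext ω
    simp only [Set.mem_ofPred_eq, Finset.mem_univ, Set.iInter_true, Set.mem_iInter, Sum.forall,
      Sum.elim_inl, Sum.elim_inr, Set.mem_preimage, Set.mem_singleton_iff, funext_iff]
  rw [hset, measureReal_def, h.indep.measure_inter_preimage_eq_mul Finset.univ
    (fun i _ => measurableSet_singleton _), ENNReal.toReal_prod, Fintype.prod_sum_type]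
  have e1 : ∀ i, (μ (X i ⁻¹' {x i})).toReal = 1 / k := fun i => h.uniform_left i (x i)
  have e2 : ∀ i, (μ (Y i ⁻¹' {y i})).toReal = 1 / k := fun i => h.uniform_right i (y i)
  simp only [Sum.elim_inl, Sum.elim_inr, e1, e2, Finset.prod_const, Finset.card_univ,
    Fintype.card_fin]
  rw [← pow_add, one_div_pow]

theorem IsIIDUniformPair.measureReal_eq_prob [NeZero k] {Ω : Type*} [MeasurableSpace Ω]
    {μ : Measure Ω} [IsProbabilityMeasure μ] {n : ℕ} {X Y : Fin n → Ω → Fin k}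
    (h : IsIIDUniformPair μ X Y) (P : List (Fin k) → List (Fin k) → Prop) :
    μ.real {ω | P (List.ofFn (fun i => X i ω)) (List.ofFn (fun i => Y i ω))} = prob n n P := by
  classical
  let S : (Fin n → Fin k) × (Fin n → Fin k) → Set Ω := fun z =>
    {ω | (fun i => X i ω) = z.1 ∧ (fun i => Y i ω) = z.2}
  have hset : {ω | P (List.ofFn (fun i => X i ω)) (List.ofFn (fun i => Y i ω))} =
      ⋃ z ∈ (Finset.univ.filter (fun z : (Fin n → Fin k) × (Fin n → Fin k) =>
        P (List.ofFn z.1) (List.ofFn z.2))), S z := by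
    ext ω
    simp only [Set.mem_ofPred_eq, Finset.mem_filter, Finset.mem_univ, true_and, Set.mem_iUnion, S]
    constructor
    · intro hω
      exact ⟨(_, _), hω, rfl, rfl⟩
    · rintro ⟨⟨x, y⟩, hP, rfl, rfl⟩
      exact hP
  have hmeas : ∀ z, MeasurableSet (S z) := by
    intro z
    exact (measurableSet_eq_fun (measurable_pi_lambda _ h.measurable_left) measurable_const).inter
      (measurableSet_eq_fun (measurable_pi_lambda _ h.measurable_right) measurable_const)
  rw [hset, measureReal_biUnion_finset ?_ fun z _ => hmeas z, prob_eq_sum,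
    ← Fintype.sum_prod_type', Finset.sum_div, Finset.sum_filter]
  · refine Finset.sum_congr rfl fun z _ => ?_
    split_ifs with hz
    · exact h.measureReal_eq z.1 z.2
    · simp
  · intro z _ w _ hzw
    refine Set.disjoint_left.2 fun ω hz hw => hzw ?_
    exact Prod.ext (hz.1.symm.trans hw.1) (hz.2.symm.trans hw.2)

end Transfer

/-! ### Block lengths and small strings -/

section BlockLength

theorem IsBlockLength.half_le {β : ℝ} (hβ : β ≤ 1) {d ℓ : ℕ} (hd : 1 ≤ d)
    (h : IsBlockLength β d ℓ) : ℓ / 2 ≤ d := by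
  have hd' : (1 : ℝ) ≤ d := by exact_mod_cast hd
  have h1 : (d : ℝ) ^ β ≤ d := by
    simpa using Real.rpow_le_rpow_of_exponent_le hd' hβ
  have h2 := (abs_lt.1 h.2).2
  have h3 : (ℓ : ℝ) < (d + 2 : ℕ) := by push_cast; linarith
  have h4 : ℓ < d + 2 := by exact_mod_cast h3
  omega

theorem eventually_blockLength_le {β : ℝ} (hβ : β < 1) {η : ℝ} (hη : 0 < η) :
    ∀ᶠ d : ℕ in atTop, ∀ ℓ : ℕ, IsBlockLength β d ℓ → (ℓ : ℝ) ≤ η * d := by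
  filter_upwards [eventually_mul_rpow_le hβ 1 (half_pos hη),
    (tendsto_natCast_atTop_atTop (R := ℝ)).eventually_ge_atTop (4 / η)] with d h1 h2 ℓ hℓ
  have h3 := (abs_lt.1 hℓ.2).2
  rw [div_le_iff₀ hη] at h2
  linarith

variable {k : ℕ} {d ℓ : ℕ} {c c' : Fin k}

theorem count_replicate_append_eq_zero (hc : c' ≠ c) {n : ℕ} {y₁ y₂ y₃ : List (Fin k)}
    (h : List.replicate n c' = y₁ ++ (y₂ ++ y₃)) : y₂.count c = 0 := by
  refine List.count_eq_zero.2 fun hmem => hc ?_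
  have : c ∈ List.replicate n c' := by
    rw [h]; simp [hmem]
  exact (List.eq_of_mem_replicate this).symm

theorem blockMatches_replicate (hℓ : Even ℓ) (hd : ℓ / 2 ≤ d) (hc : c' ≠ c) {n : ℕ}
    {x : List (Fin k)} (hx : x.length = 2 * d) {π : Finset (ℕ × ℕ)}
    (h : IsAlignment (blockList d ℓ c x) (List.replicate n c') π) : blockMatches d ℓ π = 0 := by
  obtain ⟨y₁, y₂, y₃, hyy, -, hle⟩ := exists_split_blockMatches hℓ hd hx h
  rw [count_replicate_append_eq_zero hc hyy] at hle
  omega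

theorem lcsLen_blockList_replicate_le (hc : c' ≠ c) (n : ℕ) (x : List (Fin k)) :
    lcsLen (blockList d ℓ c x) (List.replicate n c') ≤
      lcsLen (cutBlock d ℓ x) (List.replicate n c') := by
  obtain ⟨y₁, y₂, y₃, hyy, hle⟩ := exists_lcsLen_blockList_le d ℓ c x (List.replicate n c')
  rw [count_replicate_append_eq_zero hc hyy, add_zero] at hle
  refine hle.trans ((add_lcsLen_le _ _ _ _).trans (lcsLen_mono (List.Sublist.refl _) ?_))
  rw [hyy]
  exact (List.Sublist.refl _).append (List.sublist_append_right _ _)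

end BlockLength

/-! ### Exponential bounds -/

section Bounds

/-- An exponential bound for large `d`, whose polynomial prefactor is absorbed, and a positive
lower bound for each of the remaining `d` combine to an exponential bound for all `d`. -/
theorem exists_exp_bound {k : ℕ} [NeZero k] {γ b : ℝ} (hγ : 0 < γ) (hγ1 : γ ≤ 1) (hb : 0 < b)
    {ι : Type*} (V : ℕ → ι → Prop) (p : ℕ → ι → ℝ)
    (hlarge : ∀ᶠ d : ℕ in atTop, ∀ i, V d i →
      1 - 17 * (d : ℝ) ^ 2 * Real.exp (-(b * (d : ℝ) ^ γ)) ≤ p d i)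
    (hsmall : ∀ d : ℕ, 1 ≤ d → ∀ i, V d i → 1 / (k : ℝ) ^ (2 * d + 2 * d) ≤ p d i) :
    ∃ C : ℝ, 0 < C ∧ ∀ d : ℕ, 1 ≤ d → ∀ i, V d i →
      1 - Real.exp (-(C * (d : ℝ) ^ γ)) ≤ p d i := by
  have hk : (1 : ℝ) ≤ k := by exact_mod_cast Nat.pos_of_ne_zero (NeZero.ne k)
  have hexp := (tendsto_pow_mul_exp_neg_rpow 2 (half_pos hb) hγ).const_mul 17
  rw [mul_zero] at hexp
  obtain ⟨D, hD⟩ := eventually_atTop.1 (hlarge.and (hexp.eventually_le_const one_pos))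
  set C : ℝ := min (b / 2) (1 / ((k : ℝ) ^ (2 * D + 2 * D) * (D + 1))) with hC
  have hC0 : 0 < C := lt_min (half_pos hb) (by positivity)
  refine ⟨C, hC0, fun d hd i hi => ?_⟩
  have hd' : (1 : ℝ) ≤ d := by exact_mod_cast hd
  rcases le_total D d with h | h
  · obtain ⟨h1, h2⟩ := hD d h
    refine le_trans ?_ (h1 i hi)
    have h3 : 17 * (d : ℝ) ^ 2 * Real.exp (-(b * (d : ℝ) ^ γ)) =
        17 * ((d : ℝ) ^ 2 * Real.exp (-(b / 2 * (d : ℝ) ^ γ))) *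
          Real.exp (-(b / 2 * (d : ℝ) ^ γ)) := by
      rw [show -(b * (d : ℝ) ^ γ) = -(b / 2 * (d : ℝ) ^ γ) + -(b / 2 * (d : ℝ) ^ γ) by ring,
        Real.exp_add]
      ring
    have h4 : Real.exp (-(b / 2 * (d : ℝ) ^ γ)) ≤ Real.exp (-(C * (d : ℝ) ^ γ)) := by
      rw [Real.exp_le_exp, neg_le_neg_iff]
      exact mul_le_mul_of_nonneg_right (min_le_left _ _) (by positivity)
    have h5 := mul_le_mul_of_nonneg_right h2 (Real.exp_pos (-(b / 2 * (d : ℝ) ^ γ))).le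
    linarith
  · refine le_trans ?_ (hsmall d hd i hi)
    have h1 : (d : ℝ) ^ γ ≤ D + 1 := by
      have h2 : (d : ℝ) ^ γ ≤ d := by simpa using Real.rpow_le_rpow_of_exponent_le hd' hγ1
      have h3 : (d : ℝ) ≤ D := by exact_mod_cast h
      linarith
    have h2 := Real.add_one_le_exp (-(C * (d : ℝ) ^ γ))
    calc 1 - Real.exp (-(C * (d : ℝ) ^ γ)) ≤ C * (d : ℝ) ^ γ := by linarith
      _ ≤ 1 / ((k : ℝ) ^ (2 * D + 2 * D) * (D + 1)) * (D + 1) :=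
          mul_le_mul (min_le_right _ _) h1 (by positivity) (by positivity)
      _ = 1 / (k : ℝ) ^ (2 * D + 2 * D) := by field_simp
      _ ≤ 1 / (k : ℝ) ^ (2 * d + 2 * d) :=
          one_div_le_one_div_of_le (by positivity) (pow_le_pow_right₀ hk (by omega))

variable {k : ℕ} [NeZero k]

theorem eventually_increment_cut (hpos : 0 < gammaStar k)
    (hdiff : DifferentiableAt ℝ (gammaFn k) (pM k)) {α β s : ℝ} (hα : 1 / 2 < α) (hα1 : α < 1)
    (hβ : β < 1) (hs : s < gammaStar k / 2) {δ : ℝ} (hδ : 0 < δ) :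
    ∀ᶠ d : ℕ in atTop, ∀ ℓ : ℕ, IsBlockLength β d ℓ → ∀ n ≤ 2 * d,
      s * n - δ * (d : ℝ) ^ α ≤
        meanLcs k (2 * d - ℓ) (2 * d) - meanLcs k (2 * d - ℓ) (2 * d - n) := by
  obtain ⟨κ, hκ, hkey⟩ := exists_mul_sub_le_meanLcs_sub hpos hdiff hs hα hα1
  obtain ⟨m₀, hm₀⟩ := eventually_atTop.1 (hkey (δ / 2) (half_pos hδ))
  have hκ' : 0 < min 1 (2 * κ / (1 + κ)) := lt_min one_pos (by positivity)
  filter_upwards [eventually_blockLength_le hβ hκ', eventually_ge_atTop m₀] with d hd1 hd2 ℓ hℓ n hn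
  have h1 := hd1 ℓ hℓ
  have hd0 : (0 : ℝ) ≤ d := Nat.cast_nonneg d
  have h2 : (ℓ : ℝ) ≤ d :=
    h1.trans (by simpa using mul_le_mul_of_nonneg_right (min_le_left 1 (2 * κ / (1 + κ))) hd0)
  have h3 : (1 + κ) * ℓ ≤ 2 * κ * d := by
    have h4 : (ℓ : ℝ) ≤ 2 * κ / (1 + κ) * d :=
      h1.trans (mul_le_mul_of_nonneg_right (min_le_right _ _) hd0)
    rw [div_mul_eq_mul_div, le_div_iff₀ (by linarith)] at h4
    linarith
  have h2' : ℓ ≤ d := by exact_mod_cast h2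
  have hcast : ((2 * d - ℓ : ℕ) : ℝ) = 2 * d - ℓ := by
    rw [Nat.cast_sub (by omega)]; push_cast; ring
  have h5 := hm₀ (2 * d - ℓ) (by omega) (2 * d - n) (2 * d) (by omega)
    (by rw [hcast]; push_cast; linarith)
  have hcast' : ((2 * d : ℕ) : ℝ) - ((2 * d - n : ℕ) : ℝ) = n := by
    rw [Nat.cast_sub hn]; ring
  rw [hcast'] at h5
  have h6 : ((2 * d - ℓ : ℕ) : ℝ) ^ α ≤ 2 * (d : ℝ) ^ α := by
    calc ((2 * d - ℓ : ℕ) : ℝ) ^ α ≤ (2 * (d : ℝ)) ^ α := by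
          refine Real.rpow_le_rpow (Nat.cast_nonneg _) ?_ (by linarith)
          rw [hcast]
          linarith [Nat.cast_nonneg (α := ℝ) ℓ]
      _ = 2 ^ α * (d : ℝ) ^ α := Real.mul_rpow (by norm_num) hd0
      _ ≤ 2 * (d : ℝ) ^ α := by
          refine mul_le_mul_of_nonneg_right ?_ (by positivity)
          simpa using Real.rpow_le_rpow_of_exponent_le (one_le_two) hα1.le
  have h7 := mul_le_mul_of_nonneg_left h6 (half_pos hδ).le
  linarith

theorem eventually_increment_whole (hpos : 0 < gammaStar k)
    (hdiff : DifferentiableAt ℝ (gammaFn k) (pM k)) {α β s : ℝ} (hα : 1 / 2 < α) (hα1 : α < 1)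
    (hβ : β < 1) (hs : s < gammaStar k / 2) {δ : ℝ} (hδ : 0 < δ) :
    ∀ᶠ d : ℕ in atTop, ∀ ℓ : ℕ, IsBlockLength β d ℓ →
      s * ℓ - δ * (d : ℝ) ^ α ≤ meanLcs k (2 * d) (2 * d) - meanLcs k (2 * d - ℓ) (2 * d) := by
  obtain ⟨κ, hκ, hkey⟩ := exists_mul_sub_le_meanLcs_sub hpos hdiff hs hα hα1
  obtain ⟨m₀, hm₀⟩ := eventually_atTop.1 (hkey (δ / 2) (half_pos hδ))
  filter_upwards [eventually_blockLength_le hβ one_pos, eventually_ge_atTop m₀]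
    with d hd1 hd2 ℓ hℓ
  have hd0 : (0 : ℝ) ≤ d := Nat.cast_nonneg d
  have h2' : ℓ ≤ d := by
    have := hd1 ℓ hℓ
    rw [one_mul] at this
    exact_mod_cast this
  have h5 := hm₀ (2 * d) (by omega) (2 * d - ℓ) (2 * d) (by omega) (by
    have : 0 ≤ κ * ((2 * d : ℕ) : ℝ) := by positivity
    linarith)
  have hcast' : ((2 * d : ℕ) : ℝ) - ((2 * d - ℓ : ℕ) : ℝ) = ℓ := by
    rw [Nat.cast_sub (by omega)]; ring
  rw [hcast', meanLcs_comm (2 * d) (2 * d - ℓ)] at h5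
  have h6 : ((2 * d : ℕ) : ℝ) ^ α ≤ 2 * (d : ℝ) ^ α := by
    calc ((2 * d : ℕ) : ℝ) ^ α = 2 ^ α * (d : ℝ) ^ α := by
          push_cast; exact Real.mul_rpow (by norm_num) hd0
      _ ≤ 2 * (d : ℝ) ^ α := by
          refine mul_le_mul_of_nonneg_right ?_ (by positivity)
          simpa using Real.rpow_le_rpow_of_exponent_le (one_le_two) hα1.le
  have h7 := mul_le_mul_of_nonneg_left h6 (half_pos hδ).le
  linarith

theorem one_sub_le_prob_isTypical_rpow {α δ : ℝ} (hδ : 0 < δ) {d ℓ : ℕ} (hd0 : 0 < d)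
    (hℓ : Even ℓ) (hd : ℓ / 2 ≤ d) (c : Fin k) :
    1 - 17 * (d : ℝ) ^ 2 * Real.exp (-(δ ^ 2 / 8 * (d : ℝ) ^ (2 * α - 1))) ≤
      prob (2 * d) (2 * d) (IsTypical d ℓ c (δ * (d : ℝ) ^ α)) := by
  have hd0' : (0 : ℝ) < d := Nat.cast_pos.2 hd0
  have h := one_sub_le_prob_isTypical hd0 hℓ hd c (show 0 ≤ δ * (d : ℝ) ^ α by positivity)
  have e1 : (δ * (d : ℝ) ^ α) ^ 2 / (8 * d) = δ ^ 2 / 8 * (d : ℝ) ^ (2 * α - 1) := by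
    rw [Real.rpow_sub_one hd0'.ne', mul_comm 2 α, Real.rpow_mul hd0'.le, Real.rpow_two]
    field_simp
  rwa [e1] at h

end Bounds

/-! ### The block is mostly aligned with gaps -/

section Events

variable {k : ℕ} [NeZero k]

/-- The two assertions about the alignments of the block string, for lists. -/
def IsSparse (α : ℝ) (d ℓ : ℕ) (c : Fin k) (x y : List (Fin k)) : Prop :=
  (∀ π : Finset (ℕ × ℕ), IsOptimalAlignment (blockList d ℓ c x) y π →
    (blockMatches d ℓ π : ℝ) ≤ (d : ℝ) ^ α - 1) ∧
  (lcsLen (blockList d ℓ c x) y : ℝ) < (lcsLen (cutBlock d ℓ x) y : ℝ) + (d : ℝ) ^ α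

theorem tendsto_natCast_rpow {α : ℝ} (hα : 0 < α) :
    Tendsto (fun d : ℕ => (d : ℝ) ^ α) atTop atTop :=
  (tendsto_rpow_atTop hα).comp tendsto_natCast_atTop_atTop

theorem exists_exp_bound_isSparse (hk : 2 < (k : ℝ) * gammaStar k)
    (hdiff : DifferentiableAt ℝ (gammaFn k) (pM k)) (hne : ∀ c : Fin k, ∃ c' : Fin k, c' ≠ c)
    {α β : ℝ} (hα : 1 / 2 < α) (hα1 : α < 1) (hβ : β < 1) :
    ∃ C : ℝ, 0 < C ∧ ∀ d : ℕ, 1 ≤ d → ∀ i : ℕ × Fin k, IsBlockLength β d i.1 →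
      1 - Real.exp (-(C * (d : ℝ) ^ (2 * α - 1))) ≤
        prob (2 * d) (2 * d) (IsSparse α d i.1 i.2) := by
  have hk0 : (0 : ℝ) < k := Nat.cast_pos.2 (Nat.pos_of_ne_zero (NeZero.ne k))
  have hpos : 0 < gammaStar k := by
    by_contra! h
    have := mul_nonpos_of_nonneg_of_nonpos hk0.le h
    linarith
  -- `1 / k` is the density of `c`, and `gammaStar k / 2` the gain per letter freed.
  have hgap : 1 / (k : ℝ) < gammaStar k / 2 := by
    rw [div_lt_iff₀ hk0]; linarith
  set η : ℝ := (gammaStar k / 2 - 1 / k) / 2 with hη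
  have hη0 : 0 < η := by linarith
  set δ : ℝ := 1 / (2 * (5 / (η * k) + 5)) with hδ
  have hδ0 : 0 < δ := by positivity
  have hδ1 : (5 / (η * k) + 5) * δ = 1 / 2 := by rw [hδ]; field_simp
  refine exists_exp_bound (k := k) (γ := 2 * α - 1) (b := δ ^ 2 / 8) (by linarith) (by linarith) (by positivity)
    (fun d (i : ℕ × Fin k) => IsBlockLength β d i.1) _ ?_ ?_
  · filter_upwards [eventually_increment_cut (β := β) (s := 1 / k + η) hpos hdiff hα hα1 hβ
      (by linarith) hδ0, eventually_gt_atTop 0,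
      (tendsto_natCast_rpow (show 0 < α by linarith)).eventually_ge_atTop 2]
      with d hinc hd0 hd2 i hi
    have hhalf := hi.half_le hβ.le hd0
    refine (one_sub_le_prob_isTypical_rpow hδ0 hd0 hi.1 hhalf i.2).trans
      (prob_mono fun x y hx hy hT => ⟨fun π hπ => ?_, ?_⟩)
    · have h1 := hT.blockMatches_le hi.1 hhalf hx hy hη0 (hinc i.1 hi) hπ
      have h2 : (5 / (η * k) + 1) * (δ * (d : ℝ) ^ α) ≤ 1 / 2 * (d : ℝ) ^ α := by
        rw [← hδ1, mul_assoc]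
        gcongr
        norm_num
      linarith
    · have h1 := hT.lcsLen_blockList_lt hi.1 hhalf hy hη0.le (hinc i.1 hi)
      have h2 := hT.cut
      have h3 : 5 * (δ * (d : ℝ) ^ α) ≤ 1 / 2 * (d : ℝ) ^ α := by
        rw [← hδ1, mul_assoc]
        have : 0 ≤ 5 / (η * k) := by positivity
        gcongr
        linarith
      linarith
  · intro d hd i hi
    obtain ⟨c', hc'⟩ := hne i.2
    have hhalf := hi.half_le hβ.le hd
    have hd1 : (1 : ℝ) ≤ (d : ℝ) ^ α :=
      Real.one_le_rpow (by exact_mod_cast hd) (by linarith)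
    refine inv_pow_le_prob (fun _ => c') (fun _ => c') ⟨fun π hπ => ?_, ?_⟩
    · rw [List.ofFn_const] at hπ
      rw [blockMatches_replicate hi.1 hhalf hc' (by simp) hπ.1]
      simpa using hd1
    · rw [List.ofFn_const]
      have := lcsLen_blockList_replicate_le (d := d) (ℓ := i.1) hc' (2 * d)
        (List.replicate (2 * d) c')
      have h' : (lcsLen (blockList d i.1 i.2 (List.replicate (2 * d) c'))
        (List.replicate (2 * d) c') : ℝ) ≤ lcsLen (cutBlock d i.1 (List.replicate (2 * d) c'))
          (List.replicate (2 * d) c') := by exact_mod_cast this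
      linarith

/-! ### Replacing the block by iid letters -/

theorem exists_exp_bound_replacement (hk : 2 < (k : ℝ) * gammaStar k)
    (hdiff : DifferentiableAt ℝ (gammaFn k) (pM k)) (hne : ∀ c : Fin k, ∃ c' : Fin k, c' ≠ c)
    {α β : ℝ} (hα : 1 / 2 < α) (hα1 : α < 1) (hβ : β < 1) {γa : ℝ}
    (hγa : γa < gammaStar k) :
    ∃ C : ℝ, 0 < C ∧ ∀ d : ℕ, 1 ≤ d → ∀ i : ℕ × Fin k, IsBlockLength β d i.1 →
      1 - Real.exp (-(C * (d : ℝ) ^ (2 * α - 1))) ≤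
        prob (2 * d) (2 * d) (fun x y => γa / 2 * (d : ℝ) ^ β - (d : ℝ) ^ α ≤
          (lcsLen x y : ℝ) - lcsLen (blockList d i.1 i.2 x) y) := by
  have hk0 : (0 : ℝ) < k := Nat.cast_pos.2 (Nat.pos_of_ne_zero (NeZero.ne k))
  have hpos : 0 < gammaStar k := by
    by_contra! h
    have := mul_nonpos_of_nonneg_of_nonpos hk0.le h
    linarith
  have hgap : 1 / (k : ℝ) < gammaStar k / 2 := by
    rw [div_lt_iff₀ hk0]; linarith
  have hδ0 : (0 : ℝ) < 1 / 12 := by norm_num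
  refine exists_exp_bound (k := k) (γ := 2 * α - 1) (b := (1 / 12) ^ 2 / 8) (by linarith) (by linarith)
    (by positivity) (fun d (i : ℕ × Fin k) => IsBlockLength β d i.1) _ ?_ ?_
  · filter_upwards [eventually_increment_cut (β := β) (s := 1 / k + 0) hpos hdiff hα hα1 hβ
      (by linarith) hδ0, eventually_increment_whole (β := β) (s := γa / 2) hpos hdiff hα hα1 hβ
      (by linarith) hδ0, eventually_gt_atTop 0,
      (tendsto_natCast_rpow (show 0 < α by linarith)).eventually_ge_atTop (2 * |γa|)]
      with d hinc hinc' hd0 hd2 i hi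
    have hhalf := hi.half_le hβ.le hd0
    refine (one_sub_le_prob_isTypical_rpow hδ0 hd0 hi.1 hhalf i.2).trans
      (prob_mono fun x y hx hy hT => ?_)
    have h1 := hT.lcsLen_blockList_lt hi.1 hhalf hy le_rfl (hinc i.1 hi)
    have h2 := hT.whole
    have h3 := hinc' i.1 hi
    -- Rounding `d ^ β` to the block length costs at most `|γa|`.
    have h4 : γa / 2 * ((d : ℝ) ^ β - i.1) ≤ |γa| := by
      calc γa / 2 * ((d : ℝ) ^ β - i.1) ≤ |γa / 2 * ((d : ℝ) ^ β - i.1)| := le_abs_self _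
        _ = |γa| / 2 * |(i.1 : ℝ) - (d : ℝ) ^ β| := by
            rw [abs_mul, abs_div, abs_two, abs_sub_comm]
        _ ≤ |γa| / 2 * 2 := by gcongr; exact hi.2.le
        _ = |γa| := by ring
    linarith
  · intro d hd i hi
    obtain ⟨c', hc'⟩ := hne i.2
    have hhalf := hi.half_le hβ.le hd
    have hd1 : (1 : ℝ) ≤ (d : ℝ) ^ α :=
      Real.one_le_rpow (by exact_mod_cast hd) (by linarith)
    refine inv_pow_le_prob (fun _ => c') (fun _ => c') ?_
    -- Two constant strings of a letter other than `c` match completely without the block, and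
    -- lose all `ℓ` letters of the block with it.
    rw [List.ofFn_const, lcsLen_self, List.length_replicate]
    have h1 := (lcsLen_blockList_replicate_le (d := d) (ℓ := i.1) hc' (2 * d)
      (List.replicate (2 * d) c')).trans (lcsLen_le_length_left _ _)
    simp only [cutBlock, List.length_append, List.length_take, List.length_drop,
      List.length_replicate] at h1
    obtain ⟨e, he⟩ := hi.1
    have h2 : lcsLen (blockList d i.1 i.2 (List.replicate (2 * d) c'))
        (List.replicate (2 * d) c') + i.1 ≤ 2 * d := by omega
    have h3 : (lcsLen (blockList d i.1 i.2 (List.replicate (2 * d) c'))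
        (List.replicate (2 * d) c') : ℝ) + i.1 ≤ (2 * d : ℕ) := by exact_mod_cast h2
    have h4 := (abs_lt.1 hi.2).1
    have h5 : γa / 2 * (d : ℝ) ^ β ≤ 1 / 2 * (d : ℝ) ^ β := by
      have := gammaStar_le_one (k := k)
      gcongr
      linarith
    have h6 : (0 : ℝ) ≤ i.1 := Nat.cast_nonneg _
    rcases le_total ((d : ℝ) ^ β) 2 with h7 | h7 <;> linarith

end Events

end SparseBlock

theorem theorem1 (k : ℕ) (hk : 2 < (k : ℝ) * SparseBlock.gammaStar k)
    (hdiff : DifferentiableAt ℝ (SparseBlock.gammaFn k) (SparseBlock.pM k))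
    (α β : ℝ) (hα : 1 / 2 < α) (hαβ : α < β) (hβ : β < 1) :
    (∃ C_E : ℝ, 0 < C_E ∧
      ∀ d : ℕ, 1 ≤ d → ∀ ℓ : ℕ, SparseBlock.IsBlockLength β d ℓ → ∀ c : Fin k,
      ∀ (Ω : Type u) [MeasurableSpace Ω] (μ : MeasureTheory.Measure Ω)
        [MeasureTheory.IsProbabilityMeasure μ] (Xs Y : Fin (2 * d) → Ω → Fin k),
        SparseBlock.IsIIDUniformPair μ Xs Y →
          1 - Real.exp (-(C_E * (d : ℝ) ^ (2 * α - 1))) ≤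
              μ.real (SparseBlock.eventGaps α ℓ c Xs Y) ∧
          1 - Real.exp (-(C_E * (d : ℝ) ^ (2 * α - 1))) ≤
              μ.real (SparseBlock.eventCut α ℓ c Xs Y)) ∧
    (∀ γa : ℝ, γa < SparseBlock.gammaStar k → ∃ C_K : ℝ, 0 < C_K ∧
      ∀ d : ℕ, 1 ≤ d → ∀ ℓ : ℕ, SparseBlock.IsBlockLength β d ℓ → ∀ c : Fin k,
      ∀ (Ω : Type u) [MeasurableSpace Ω] (μ : MeasureTheory.Measure Ω)
        [MeasureTheory.IsProbabilityMeasure μ] (Xs Y : Fin (2 * d) → Ω → Fin k),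
        SparseBlock.IsIIDUniformPair μ Xs Y →
          1 - Real.exp (-(C_K * (d : ℝ) ^ (2 * α - 1))) ≤
              μ.real (SparseBlock.eventK α β γa ℓ c Xs Y)) := by
  open SparseBlock in
  have hk0 : k ≠ 0 := by
    rintro rfl
    norm_num at hk
  have : NeZero k := ⟨hk0⟩
  have hk1 : 1 < k := by
    have h1 : (k : ℝ) * gammaStar k ≤ k * 1 :=
      mul_le_mul_of_nonneg_left gammaStar_le_one (Nat.cast_nonneg k)
    have h2 : (1 : ℝ) < k := by linarith
    exact_mod_cast h2
  have : Nontrivial (Fin k) := Fin.nontrivial_iff_two_le.2 hk1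
  have hne : ∀ c : Fin k, ∃ c' : Fin k, c' ≠ c := fun c => exists_ne c
  have hα1 : α < 1 := hαβ.trans hβ
  refine ⟨?_, fun γa hγa => ?_⟩
  · obtain ⟨C, hC, hbound⟩ := exists_exp_bound_isSparse hk hdiff hne hα hα1 hβ
    refine ⟨C, hC, fun d hd ℓ hℓ c Ω _ μ _ Xs Y hXY => ?_⟩
    have hhalf := hℓ.half_le hβ.le hd
    have h := hbound d hd (ℓ, c) hℓ
    constructor
    · refine (h.trans (prob_mono fun x y _ _ hS => hS.1)).trans (le_of_eq ?_)
      rw [← hXY.measureReal_eq_prob, eventGaps]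
      simp only [withBlock_eq_blockList hℓ.1 hhalf]
    · refine (h.trans (prob_mono fun x y _ _ hS => hS.2)).trans (le_of_eq ?_)
      rw [← hXY.measureReal_eq_prob, eventCut]
      simp only [withBlock_eq_blockList hℓ.1 hhalf, cutBlock_blockList hℓ.1 hhalf,
        List.length_ofFn]
  · obtain ⟨C, hC, hbound⟩ := exists_exp_bound_replacement hk hdiff hne hα hα1 hβ hγa
    refine ⟨C, hC, fun d hd ℓ hℓ c Ω _ μ _ Xs Y hXY => ?_⟩
    have hhalf := hℓ.half_le hβ.le hd
    refine (hbound d hd (ℓ, c) hℓ).trans (le_of_eq ?_)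
    rw [← hXY.measureReal_eq_prob, eventK]
    simp only [withBlock_eq_blockList hℓ.1 hhalf]
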